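/- Let $k\ge 1$, $1\le l<n$ and $m\ge 1$, let $V,W$ be real vector spaces of dimensions $n,m$, and let $\theta_k\in J^k=J^k(V,W)$ be a $k$-jet of maps $V\to W$, i.e. a base point in $V$ together with symmetric forms $u_r\in S^rV^*\otimes W$, $r=0,\dots,k$ (the derivatives at that point). (In adapted coordinates every $k$-jet of an $n$-dimensional submanifold of an $(n+m)$-dimensional manifold is of this form, with $V$ the tangent space $\underline R$ of the submanifold and $W$ the normal space $N$; what follows depends only on a neighbourhood of the base point.) Let $\mathcal C_{\theta_k}\subset T_{\theta_k}J^k$ be the Cartan plane, the common kernel of the contact forms $du_r-u_{r+1}(dx,\cdot,\dots,\cdot)$, $0\le r<k$, and let $\Omega(X,Y)=\dot u_k^X(\dot x^Y,\cdot)-\dot u_k^Y(\dot x^X,\cdot)\in S^{k-1}V^*\otimes W$ be the metasymplectic form (the curvature form of the Cartan distribution) on it. A horizontal integral element is a subspace of $\mathcal C_{\theta_k}$ on which $\Omega$ vanishes and which is transverse to the fibres of $J^k\to J^{k-1}$; those of the maximal dimension $n$ are the R-planes, and they correspond bijectively to the $(k+1)$-jets $\theta_{k+1}\in J^{k+1}_{\theta_k}$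 extending $\theta_k$, which form an affine space over $S^{k+1}V^*\otimes W$. Let $I=I^{l,n}_{\theta_k}$ be the space of flags $(L,R)$ with $L\subset R$, $R$ an R-plane and $L$ an $l$-dimensional horizontal integral element. Writing $\underline L\subset V$ for the projection of $L$, the map $(L,R_{\theta_{k+1}})\mapsto(\underline L,\theta_{k+1})$ identifies $I$ with the manifold $\mathrm{Gr}(V,l)\times J^{k+1}_{\theta_k}$, so that $T_{(L,R)}I=\mathrm{Hom}(\underline L,V/\underline L)\oplus(S^{k+1}V^*\otimes W)$; let $\mathrm{pr}_n:I\to J^{k+1}_{\theta_k}$ be the projection $(L,R_{\theta_{k+1}})\mapsto\theta_{k+1}$. For $0\le p\le k+2$ let $\mu^p_{\underline L}\subset S^{k+1}V^*\otimes W$ be the space of symmetric $(k+1)$-linear forms that vanish as soon as $p$ of their arguments lie in $\underline L$ (equivalently, of homogeneous polynomials of degree $k+1$ that vanish after $p$ derivatives in directions of $\underline L$), and let $\mathcal V^p_{(L,R)}=\{0\oplus f: f\in\mu^p_{\underline L}\}$. For $0\le p\le k+1$ let $\mathcal F^p=\mathcal V^{p+1}+V\mathrm{pr}_n$, where $V\mathrm{pr}_n$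 is the distribution of vectors tangent to the fibres of $\mathrm{pr}_n$. The characteristic distribution of a distribution $\mathcal E$ is the one spanned by the (local) vector fields $X$ in $\mathcal E$ such that $[X,Y]$ lies in $\mathcal E$ for every section $Y$ of $\mathcal E$. Then: 1. For $p=0,\dots,k$ the characteristic distribution of $\mathcal F^p$ is $\mathcal V^p$. 2. For $p=k+1$ one has $\mathcal F^{k+1}=TI$, and its characteristic distribution is all of $TI$ (so it contains $\mathcal V^{k+1}$). 3. For $p=0,\dots,k+1$ the distribution $\mathcal F^p$ descends to the leaf space $M^{k+1-p}$ of $\mathcal V^p$: the leaf space, with the quotient topology, has a smooth structure for which the projection $\pi:I\to M^{k+1-p}$ is a smooth submersion, and there is a smooth distribution $\underline{\mathcal F}$ on $M^{k+1-p}$ such that $\mathcal F^p_x=(T_x\pi)^{-1}\big(\underline{\mathcal F}_{\pi(x)}\big)$ for all $x\in I$. -/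

import Mathlib

open Module Set Manifold
open scoped ContDiff Topology

noncomputable section

namespace FlagJets

/-! ### Distributions, characteristic symmetries and leaf spaces on a manifold -/

section Distributions

variable {E : Type*} [NormedAddCommGroup E] [NormedSpace ℝ E]
variable {M : Type*} [TopologicalSpace M] [ChartedSpace E M]

variable (E M) in
/-- A field of tangent subspaces on the manifold `M`. -/
abbrev Distribution := ∀ x : M, Submodule ℝ (TangentSpace 𝓘(ℝ, E) x)

variable (E M) in
/-- A (not necessarily continuous) vector field on `M`. -/
abbrev VField := ∀ x : M, TangentSpace 𝓘(ℝ, E) x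

/-- The vector field `X` is smooth on `U`. -/
def SmoothOn [IsManifold 𝓘(ℝ, E) ∞ M] (X : VField E M) (U : Set M) : Prop :=
  haveI : IsManifold 𝓘(ℝ, E) 1 M := IsManifold.of_le (n := ∞) (by simp)
  ContMDiffOn 𝓘(ℝ, E) 𝓘(ℝ, E).tangent ∞
    (fun x => (⟨x, X x⟩ : TangentBundle 𝓘(ℝ, E) M)) U

/-- `D` is a smooth distribution: locally it is spanned by a smooth frame. -/
def IsSmoothDistribution [IsManifold 𝓘(ℝ, E) ∞ M] (D : Distribution E M) : Prop :=
  ∀ x : M, ∃ U : Set M, IsOpen U ∧ x ∈ U ∧ ∃ (r : ℕ) (X : Fin r → VField E M),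
    (∀ i, SmoothOn (X i) U) ∧
    ∀ y ∈ U, LinearIndependent ℝ (fun i => X i y) ∧
      Submodule.span ℝ (Set.range fun i => X i y) = D y

/-- `X` is a smooth section of the distribution `D` over `U`. -/
def IsSectionOn [IsManifold 𝓘(ℝ, E) ∞ M] (D : Distribution E M) (U : Set M)
    (X : VField E M) : Prop :=
  SmoothOn X U ∧ ∀ y ∈ U, X y ∈ D y

/-- `X` is, over `U`, a characteristic symmetry of `D`: it lies in `D`, and its Lie brackets with
(local) sections of `D` lie in `D`. -/
def IsCharSymmetryOn [IsManifold 𝓘(ℝ, E) ∞ M] (D : Distribution E M) (U : Set M)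
    (X : VField E M) : Prop :=
  IsSectionOn D U X ∧ ∀ U' ⊆ U, IsOpen U' → ∀ Y : VField E M, IsSectionOn D U' Y →
    ∀ y ∈ U', VectorField.mlieBracket 𝓘(ℝ, E) X Y y ∈ D y

/-- The characteristic distribution of `D`: its plane at `x` is spanned by the values at `x` of
the characteristic symmetries of `D` that are defined near `x`. -/
def charDistribution [IsManifold 𝓘(ℝ, E) ∞ M] (D : Distribution E M) : Distribution E M :=
  fun x => Submodule.span ℝ
    {v | ∃ (U : Set M) (X : VField E M), IsOpen U ∧ x ∈ U ∧ IsCharSymmetryOn D U X ∧ X x = v}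

/-- `x` and `y` are joined by a smooth curve that is everywhere tangent to `D`. -/
def TangentCurveJoins (D : Distribution E M) (x y : M) : Prop :=
  ∃ γ : ℝ → M, ContMDiff 𝓘(ℝ, ℝ) 𝓘(ℝ, E) ∞ γ ∧
    (∀ t : ℝ, mfderiv 𝓘(ℝ, ℝ) 𝓘(ℝ, E) γ t (1 : ℝ) ∈ D (γ t)) ∧ γ 0 = x ∧ γ 1 = y

/-- The leaf of an involutive distribution `D` through `x` consists of the points that can be
reached from `x` by finitely many smooth curves tangent to `D`. -/
def leafSetoid (D : Distribution E M) : Setoid M :=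
  Relation.EqvGen.setoid (TangentCurveJoins D)

/-- The space of leaves of `D`, with the quotient topology. -/
def LeafSpace (D : Distribution E M) : Type _ := Quotient (leafSetoid D)

instance (D : Distribution E M) : TopologicalSpace (LeafSpace D) :=
  inferInstanceAs (TopologicalSpace (Quotient (leafSetoid D)))

/-- The projection that sends a point to its leaf. -/
def leafProj (D : Distribution E M) (x : M) : LeafSpace D := Quotient.mk (leafSetoid D) x

/-- The distribution `D` descends to the leaf space of `K`: the leaf space is a smooth manifold
(with the quotient topology), the projection to it is a smooth submersion (these two requirements
determine the smooth structure), and `D` is the preimage of a smooth distribution on it. -/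
def DescendsToLeafSpace (D K : Distribution E M) : Prop :=
  ∃ (N : ℕ) (_ : ChartedSpace (EuclideanSpace ℝ (Fin N)) (LeafSpace K))
    (_ : IsManifold 𝓘(ℝ, EuclideanSpace ℝ (Fin N)) ∞ (LeafSpace K)),
    ContMDiff 𝓘(ℝ, E) 𝓘(ℝ, EuclideanSpace ℝ (Fin N)) ∞ (leafProj K) ∧
    (∀ x, Function.Surjective
      (mfderiv 𝓘(ℝ, E) 𝓘(ℝ, EuclideanSpace ℝ (Fin N)) (leafProj K) x)) ∧
    ∃ D' : Distribution (EuclideanSpace ℝ (Fin N)) (LeafSpace K),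
      IsSmoothDistribution D' ∧
      ∀ x, D x = (D' (leafProj K x)).comap
        (mfderiv 𝓘(ℝ, E) 𝓘(ℝ, EuclideanSpace ℝ (Fin N)) (leafProj K) x).toLinearMap

end Distributions

/-! ### Manifolds given by a family of parametrizations -/

/-- A family of injective parametrizations of the set `M` by the normed space `E`, jointly
surjective, with open overlap domains and smooth changes of parameters. -/
structure ParamAtlas (ι E M : Type*) [NormedAddCommGroup E] [NormedSpace ℝ E] where
  φ : ι → E → M
  inj : ∀ i, Function.Injective (φ i)
  surj : ∀ x, ∃ i, x ∈ Set.range (φ i)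
  isOpen_overlap : ∀ i j, IsOpen {a | φ i a ∈ Set.range (φ j)}
  exists_change : ∀ i j, ∃ τ : E → E, ContDiffOn ℝ ∞ τ {a | φ i a ∈ Set.range (φ j)} ∧
    ∀ a, φ i a ∈ Set.range (φ j) → φ j (τ a) = φ i a

namespace ParamAtlas

variable {ι E M : Type*} [NormedAddCommGroup E] [NormedSpace ℝ E] (P : ParamAtlas ι E M)

/-- The chart inverse to a parametrization. -/
def chart (i : ι) : PartialEquiv M E :=
  (Set.InjOn.toPartialEquiv (P.φ i) Set.univ (P.inj i).injOn).symm

lemma chart_source (i : ι) : (P.chart i).source = Set.range (P.φ i) := by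
  simp [chart]

lemma chart_symm_apply (i : ι) (a : E) : (P.chart i).symm a = P.φ i a := rfl

lemma chart_apply (i : ι) (a : E) : P.chart i (P.φ i a) = a :=
  (P.chart i).right_inv (x := a) (by simp [chart])

lemma trans_source (i j : ι) :
    ((P.chart i).symm.trans (P.chart j)).source = {a | P.φ i a ∈ Set.range (P.φ j)} := by
  ext a
  rw [PartialEquiv.trans_source, chart_source]
  simp [chart, Set.InjOn.toPartialEquiv]

lemma contDiffOn_trans (i j : ι) :
    ContDiffOn ℝ ∞ ((P.chart i).symm.trans (P.chart j))
      ((P.chart i).symm.trans (P.chart j)).source := by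
  rw [trans_source]
  obtain ⟨τ, hτ, h⟩ := P.exists_change i j
  refine hτ.congr fun a ha => ?_
  change P.chart j (P.φ i a) = τ a
  rw [← h a ha, chart_apply]

/-- The charts inverse to the parametrizations. -/
def core : ChartedSpaceCore E M where
  atlas := Set.range P.chart
  chartAt x := P.chart (P.surj x).choose
  mem_chart_source x := by rw [chart_source]; exact (P.surj x).choose_spec
  chart_mem_atlas x := ⟨_, rfl⟩
  open_source := by
    rintro _ _ ⟨i, rfl⟩ ⟨j, rfl⟩
    rw [trans_source]; exact P.isOpen_overlap i j
  continuousOn_toFun := by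
    rintro _ _ ⟨i, rfl⟩ ⟨j, rfl⟩
    exact (P.contDiffOn_trans i j).continuousOn

lemma isManifold :
    letI := P.core.toTopologicalSpace
    letI := P.core.toChartedSpace
    IsManifold 𝓘(ℝ, E) ∞ M := by
  let _ := P.core.toTopologicalSpace
  let _ := P.core.toChartedSpace
  apply isManifold_of_contDiffOn
  intro e e' he he'
  change e ∈ ⋃ (e : PartialEquiv M E) (he : e ∈ P.core.atlas),
    {P.core.openPartialHomeomorph e he} at he
  change e' ∈ ⋃ (e : PartialEquiv M E) (he : e ∈ P.core.atlas),
    {P.core.openPartialHomeomorph e he} at he'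
  simp only [mem_iUnion, mem_singleton_iff] at he he'
  obtain ⟨_, ⟨i, rfl⟩, rfl⟩ := he
  obtain ⟨_, ⟨j, rfl⟩, rfl⟩ := he'
  have h := P.contDiffOn_trans i j
  simp only [modelWithCornersSelf_coe, modelWithCornersSelf_coe_symm, Function.comp_id,
    Function.id_comp, Set.preimage_id, Set.range_id, Set.inter_univ]
  exact h

end ParamAtlas

/-! ### Grassmannians -/

section Grassmannian

variable (V : Type*) [NormedAddCommGroup V] [NormedSpace ℝ V] (l : ℕ)

/-- The Grassmannian of `l`-dimensional subspaces of `V`. -/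
@[ext] structure Gr where
  plane : Submodule ℝ V
  finrank_eq : finrank ℝ plane = l

/-- The model space of the Grassmannian: matrices of size `(dim V - l) × l`. -/
abbrev GrModel := (Fin l → ℝ) →L[ℝ] (Fin (finrank ℝ V - l) → ℝ)

/-- Splittings of `V` as a sum of an `l`-dimensional and a complementary coordinate space. -/
abbrev GrFrame := V ≃L[ℝ] (Fin l → ℝ) × (Fin (finrank ℝ V - l) → ℝ)

variable {V l}

/-- The plane with equation `y = A x`, where `(x, y)` are the coordinates given by `e`. -/
def grGraph (e : GrFrame V l) (A : GrModel V l) : Gr V l where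
  plane := A.toLinearMap.graph.map (e.symm.toLinearEquiv : _ →ₗ[ℝ] V)
  finrank_eq := by
    rw [LinearEquiv.finrank_map_eq, ← LinearEquiv.finrank_eq (LinearEquiv.ofInjective
      (LinearMap.prod LinearMap.id A.toLinearMap) (fun x y h => congrArg Prod.fst h) ≪≫ₗ
      LinearEquiv.ofEq _ _ A.toLinearMap.graph_eq_range_prod.symm)]
    simp

lemma mem_grGraph {e : GrFrame V l} {A : GrModel V l} {v : V} :
    v ∈ (grGraph e A).plane ↔ (e v).2 = A (e v).1 := by
  simp only [grGraph, Submodule.mem_map]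
  constructor
  · rintro ⟨w, hw, rfl⟩
    simpa [LinearMap.mem_graph_iff] using hw
  · intro h
    exact ⟨e v, by simpa [LinearMap.mem_graph_iff] using h, by simp⟩

lemma grGraph_injective (e : GrFrame V l) : Function.Injective (grGraph e) := by
  intro A B h
  ext1 x
  have h1 : e.symm (x, A x) ∈ (grGraph e B).plane := by
    rw [← h, mem_grGraph]; simp
  simpa [mem_grGraph] using h1

lemma finiteDimensional_of_frame (e : GrFrame V l) : FiniteDimensional ℝ V :=
  LinearEquiv.finiteDimensional e.symm.toLinearEquiv

lemma exists_grGraph [FiniteDimensional ℝ V] (L : Gr V l) :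
    ∃ e : GrFrame V l, ∃ A, grGraph e A = L := by
  obtain ⟨L', hL'⟩ := Submodule.exists_isCompl L.plane
  have hd : finrank ℝ L' = finrank ℝ V - l := by
    have := Submodule.finrank_add_eq_of_isCompl hL'
    rw [L.finrank_eq] at this
    omega
  let a : L.plane ≃ₗ[ℝ] (Fin l → ℝ) := LinearEquiv.ofFinrankEq _ _ (by simp [L.finrank_eq])
  let b : L' ≃ₗ[ℝ] (Fin (finrank ℝ V - l) → ℝ) := LinearEquiv.ofFinrankEq _ _ (by simp [hd])
  let e : V ≃ₗ[ℝ] _ := (Submodule.prodEquivOfIsCompl _ _ hL').symm ≪≫ₗ a.prodCongr b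
  refine ⟨e.toContinuousLinearEquiv, 0, ?_⟩
  ext v
  rw [mem_grGraph]
  simp [e]

/-- The first component of a change of frames along the graph of `A`. -/
def grFst (e e' : GrFrame V l) (A : GrModel V l) : (Fin l → ℝ) →L[ℝ] (Fin l → ℝ) :=
  (ContinuousLinearMap.fst ℝ _ _ ∘L (e.symm.trans e').toContinuousLinearMap) ∘L
    (ContinuousLinearMap.inl ℝ _ _ + ContinuousLinearMap.inr ℝ _ _ ∘L A)

/-- The second component of a change of frames along the graph of `A`. -/
def grSnd (e e' : GrFrame V l) (A : GrModel V l) : GrModel V l :=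
  (ContinuousLinearMap.snd ℝ _ _ ∘L (e.symm.trans e').toContinuousLinearMap) ∘L
    (ContinuousLinearMap.inl ℝ _ _ + ContinuousLinearMap.inr ℝ _ _ ∘L A)

lemma grFst_apply (e e' : GrFrame V l) (A : GrModel V l) (x : Fin l → ℝ) :
    grFst e e' A x = (e' (e.symm (x, A x))).1 := by
  have : (x, A x) = (x, 0) + (0, A x) := by simp
  rw [this, map_add, map_add]
  simp [grFst]

lemma grSnd_apply (e e' : GrFrame V l) (A : GrModel V l) (x : Fin l → ℝ) :
    grSnd e e' A x = (e' (e.symm (x, A x))).2 := by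
  have : (x, A x) = (x, 0) + (0, A x) := by simp
  rw [this, map_add, map_add]
  simp [grSnd]

lemma contDiff_grFst (e e' : GrFrame V l) : ContDiff ℝ ∞ (grFst e e') := by
  unfold grFst
  refine contDiff_const.clm_comp ?_
  exact contDiff_const.add (contDiff_const.clm_comp contDiff_id)

lemma contDiff_grSnd (e e' : GrFrame V l) : ContDiff ℝ ∞ (grSnd e e') := by
  unfold grSnd
  refine contDiff_const.clm_comp ?_
  exact contDiff_const.add (contDiff_const.clm_comp contDiff_id)

lemma grGraph_eq_iff (e e' : GrFrame V l) (A B : GrModel V l) :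
    grGraph e' B = grGraph e A ↔ IsUnit (grFst e e' A) ∧ grSnd e e' A = B ∘L grFst e e' A := by
  have := finiteDimensional_of_frame e
  constructor
  · intro h
    have h1 : ∀ x, (grSnd e e' A) x = B (grFst e e' A x) := by
      intro x
      have : e.symm (x, A x) ∈ (grGraph e' B).plane := by
        rw [h, mem_grGraph]; simp
      rw [mem_grGraph] at this
      rw [grFst_apply, grSnd_apply]; exact this
    refine ⟨?_, ContinuousLinearMap.ext h1⟩
    have hi : Function.Injective (grFst e e' A) := by
      rw [injective_iff_map_eq_zero]
      intro x hx
      have h2 := h1 x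
      rw [hx, map_zero] at h2
      have h3 : e' (e.symm (x, A x)) = 0 := by
        ext1
        · rwa [grFst_apply] at hx
        · rwa [grSnd_apply] at h2
      have h4 : (x, A x) = 0 := by simpa using h3
      exact congrArg Prod.fst h4
    rw [ContinuousLinearMap.isUnit_iff_bijective]
    exact ⟨hi, LinearMap.injective_iff_surjective (f := (grFst e e' A).toLinearMap) |>.1 hi⟩
  · rintro ⟨_, h⟩
    have hle : (grGraph e A).plane ≤ (grGraph e' B).plane := by
      intro v hv
      rw [mem_grGraph] at hv ⊢
      have := DFunLike.congr_fun h (e v).1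
      simpa [grFst_apply, grSnd_apply, ← hv] using this
    ext1
    refine (Submodule.eq_of_le_of_finrank_eq hle ?_).symm
    rw [(grGraph e A).finrank_eq, (grGraph e' B).finrank_eq]

lemma mem_range_grGraph_iff (e e' : GrFrame V l) (A : GrModel V l) :
    grGraph e A ∈ Set.range (grGraph e') ↔ IsUnit (grFst e e' A) := by
  constructor
  · rintro ⟨B, h⟩
    exact ((grGraph_eq_iff e e' A B).1 h).1
  · intro h
    refine ⟨grSnd e e' A ∘L Ring.inverse (grFst e e' A), (grGraph_eq_iff e e' A _).2 ⟨h, ?_⟩⟩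
    have := Ring.inverse_mul_cancel _ h
    rw [ContinuousLinearMap.mul_def] at this
    rw [ContinuousLinearMap.comp_assoc, this, ContinuousLinearMap.one_def,
      ContinuousLinearMap.comp_id]

lemma contDiffOn_grChange (e e' : GrFrame V l) :
    ContDiffOn ℝ ∞ (fun A => grSnd e e' A ∘L Ring.inverse (grFst e e' A))
      {A | grGraph e A ∈ Set.range (grGraph e')} := by
  intro A hA
  obtain ⟨u, hu⟩ := (mem_range_grGraph_iff e e' A).1 hA
  refine ContDiffAt.contDiffWithinAt ?_
  refine (contDiff_grSnd e e').contDiffAt.clm_comp ?_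
  have h1 := contDiffAt_ringInverse ℝ (n := ∞) u
  rw [hu] at h1
  exact h1.comp A (contDiff_grFst e e').contDiffAt

variable (V l) in
/-- The standard affine parametrizations of the Grassmannian: every frame `e` of `V` gives the
parametrization of the planes transverse to `x = 0` by matrices `A`, through `y = A x`. -/
def grAtlas [FiniteDimensional ℝ V] : ParamAtlas (GrFrame V l) (GrModel V l) (Gr V l) where
  φ := grGraph
  inj := grGraph_injective
  surj L := exists_grGraph L
  isOpen_overlap e e' := by
    simp only [mem_range_grGraph_iff]
    exact Units.isOpen.preimage (contDiff_grFst e e').continuous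
  exists_change e e' := by
    refine ⟨_, contDiffOn_grChange e e', fun A hA => ?_⟩
    obtain ⟨B, hB⟩ := hA
    have h := (grGraph_eq_iff e e' A B).1 hB
    rw [← hB]
    have := Ring.mul_inverse_cancel _ h.1
    rw [ContinuousLinearMap.mul_def] at this
    rw [h.2, ContinuousLinearMap.comp_assoc, this, ContinuousLinearMap.one_def,
      ContinuousLinearMap.comp_id]

variable [FiniteDimensional ℝ V]

instance : TopologicalSpace (Gr V l) := (grAtlas V l).core.toTopologicalSpace

instance : ChartedSpace (GrModel V l) (Gr V l) := (grAtlas V l).core.toChartedSpace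

instance : IsManifold 𝓘(ℝ, GrModel V l) ∞ (Gr V l) := (grAtlas V l).isManifold

end Grassmannian

/-! ### Jets of maps `V → W`, the Cartan plane and integral elements -/

section Jets

variable (V W : Type*) [NormedAddCommGroup V] [NormedSpace ℝ V]
  [NormedAddCommGroup W] [NormedSpace ℝ W]

/-- Symmetric `r`-linear forms on `V` with values in `W`, i.e. the elements of `S^r V^* ⊗ W`,
which correspond to homogeneous polynomial maps `V → W` of degree `r`. -/
def symForms (r : ℕ) : Submodule ℝ (V [×r]→L[ℝ] W) where
  carrier := {f | ∀ (σ : Equiv.Perm (Fin r)) (w : Fin r → V), f (w ∘ σ) = f w}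
  add_mem' hf hg σ w := by simp [hf σ w, hg σ w]
  zero_mem' σ w := by simp
  smul_mem' c f hf σ w := by simp [hf σ w]

/-- The space `S^r V^* ⊗ W`, as a type. -/
abbrev SymForm (r : ℕ) := ↥(symForms V W r)

variable {V W}

/-- Insertion of a vector into the first slot of a symmetric form: `ins f v = f (v, ·, …, ·)`.
On homogeneous polynomials this is the derivative in the direction `v`, up to normalization. -/
def ins {r : ℕ} (f : SymForm V W (r + 1)) (v : V) : SymForm V W r :=
  ⟨f.1.curryLeft v, fun σ w => by
    have h := f.2 (Equiv.Perm.decomposeFin.symm (0, σ)) (Fin.cons v w)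
    have h2 : (Fin.cons v w : Fin (r + 1) → V) ∘ (Equiv.Perm.decomposeFin.symm (0, σ)) =
        Fin.cons v (w ∘ σ) := by
      funext i
      refine Fin.cases ?_ (fun j => ?_) i <;> simp
    rw [h2] at h
    simpa using h⟩

/-- Insertion of a vector into a form of arbitrary degree (it is zero in degree zero). -/
def contract : {r : ℕ} → SymForm V W r → V → SymForm V W (r - 1)
  | 0, _, _ => 0
  | _ + 1, f, v => ins f v

lemma ins_apply {r : ℕ} (f : SymForm V W (r + 1)) (v : V) (w : Fin r → V) :
    (ins f v).1 w = f.1 (Fin.cons v w) := rfl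

lemma ins_add {r : ℕ} (f : SymForm V W (r + 1)) (v v' : V) :
    ins f (v + v') = ins f v + ins f v' := by
  ext w; simp [ins]

lemma ins_smul {r : ℕ} (f : SymForm V W (r + 1)) (c : ℝ) (v : V) :
    ins f (c • v) = c • ins f v := by
  ext w; simp [ins]

lemma ins_zero {r : ℕ} (f : SymForm V W (r + 1)) : ins f 0 = 0 := by
  ext w; simp [ins]

variable (V W) in
/-- The space `J^k(V, W)` of `k`-jets of maps `V → W`, in its standard coordinates: a jet consists
of a base point in `V` and of the derivatives of order `0, …, k` at this point. -/
abbrev Jet (k : ℕ) := V × ((r : Fin (k + 1)) → SymForm V W r)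

variable {k : ℕ}

/-- The Cartan plane at the jet `θ`, a subspace of `T_θ J^k = V × ∏ S^r V^* ⊗ W`: the common
kernel of the contact forms `du_r - u_{r+1}(dx, ·)`, `r < k`. -/
def cartanPlane (θ : Jet V W k) : Submodule ℝ (Jet V W k) where
  carrier := {X | ∀ r : Fin k, X.2 r.castSucc = ins (r := r) (θ.2 r.succ) X.1}
  add_mem' {X Y} hX hY r := by
    have := ins_add (r := r) (θ.2 r.succ) X.1 Y.1
    rw [← hX r, ← hY r] at this
    exact this.symm
  zero_mem' r := (ins_zero (r := r) (θ.2 r.succ)).symm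
  smul_mem' c X hX r := by
    have := ins_smul (r := r) (θ.2 r.succ) c X.1
    rw [← hX r] at this
    exact this.symm

/-- The top order component of a tangent vector of `J^k`. -/
def topComp (X : Jet V W k) : SymForm V W k := X.2 (Fin.last k)

/-- The metasymplectic form (the curvature form of the Cartan distribution), with values in
`S^{k-1} V^* ⊗ W`; it is applied to vectors of a Cartan plane only. In coordinates
`Ω(∂_{u_σ}, D_i) = ∂_{u_{σ - 1_i}}` for `|σ| = k`, while two total derivatives, or two vertical
vectors, are `Ω`-orthogonal. -/
def metasymplectic (X Y : Jet V W k) : SymForm V W (k - 1) :=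
  contract (topComp X) Y.1 - contract (topComp Y) X.1

/-- `L` is a horizontal `l`-dimensional integral element of the Cartan distribution at `θ`:
horizontal means transverse to the fibres of `J^k → J^{k-1}`. -/
structure IsIntegralElement (θ : Jet V W k) (l : ℕ) (L : Submodule ℝ (Jet V W k)) : Prop where
  le_cartan : L ≤ cartanPlane θ
  finrank_eq : finrank ℝ L = l
  isotropic : ∀ X ∈ L, ∀ Y ∈ L, metasymplectic X Y = 0
  horizontal : ∀ X ∈ L, X.1 = 0 → (∀ r : Fin k, X.2 r.castSucc = 0) → X = 0

/-- The space of integral flags `L ⊂ R ⊂ C_θ` with `L` of dimension `l` and `R` an R-plane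
(a horizontal integral element of the maximal dimension `dim V`). -/
@[ext] structure Flag (θ : Jet V W k) (l : ℕ) where
  small : Submodule ℝ (Jet V W k)
  big : Submodule ℝ (Jet V W k)
  small_mem : IsIntegralElement θ l small
  big_mem : IsIntegralElement θ (finrank ℝ V) big
  small_le_big : small ≤ big

/-- The space of `(k+1)`-jets that extend the `k`-jet `θ`: such a jet consists of `θ` together
with its derivative of order `k + 1`. -/
abbrev JetExt (_ : Jet V W k) := SymForm V W (k + 1)

/-- The R-plane of the `(k+1)`-jet `(θ, s)`: the tangent plane at `θ` of the `k`-jet prolongation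
of any map with this `(k+1)`-jet. -/
def rPlane (θ : Jet V W k) (s : JetExt θ) : Submodule ℝ (Jet V W k) where
  carrier := {X | X ∈ cartanPlane θ ∧ topComp X = ins s X.1}
  add_mem' {X Y} hX hY := ⟨add_mem hX.1 hY.1, by
    rw [Prod.fst_add, ins_add, ← hX.2, ← hY.2]; rfl⟩
  zero_mem' := ⟨zero_mem _, (ins_zero s).symm⟩
  smul_mem' c X hX := ⟨Submodule.smul_mem _ c hX.1, by
    rw [Prod.smul_fst, ins_smul, ← hX.2]; rfl⟩

lemma mem_cartanPlane {θ X : Jet V W k} :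
    X ∈ cartanPlane θ ↔ ∀ r : Fin k, X.2 r.castSucc = ins (r := r) (θ.2 r.succ) X.1 := Iff.rfl

lemma mem_rPlane {θ X : Jet V W k} {s : JetExt θ} :
    X ∈ rPlane θ s ↔ X ∈ cartanPlane θ ∧ topComp X = ins s X.1 := Iff.rfl

lemma eq_of_mem_cartanPlane {θ X Y : Jet V W k} (hX : X ∈ cartanPlane θ) (hY : Y ∈ cartanPlane θ)
    (h1 : X.1 = Y.1) (h2 : topComp X = topComp Y) : X = Y := by
  refine Prod.ext h1 (funext fun r => ?_)
  refine Fin.lastCases h2 (fun i => ?_) r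
  rw [hX i, hY i, h1]

/-- The vector of the R-plane of `(θ, s)` over `v`. -/
def rVec (θ : Jet V W k) (s : JetExt θ) (v : V) : Jet V W k :=
  (v, fun r => Fin.lastCases (motive := fun r => SymForm V W r) (ins (r := k) s v)
    (fun i => (ins (r := i) (θ.2 i.succ) v)) r)

lemma topComp_rVec (θ : Jet V W k) (s : JetExt θ) (v : V) : topComp (rVec θ s v) = ins s v := by
  simp [topComp, rVec]

lemma rVec_mem (θ : Jet V W k) (s : JetExt θ) (v : V) : rVec θ s v ∈ rPlane θ s := by
  refine ⟨fun r => ?_, topComp_rVec θ s v⟩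
  simp [rVec]

lemma eq_rVec {θ X : Jet V W k} {s : JetExt θ} (hX : X ∈ rPlane θ s) : X = rVec θ s X.1 :=
  eq_of_mem_cartanPlane hX.1 (rVec_mem θ s X.1).1 rfl (by rw [topComp_rVec, hX.2])

/-- The projection of an R-plane to `V` is an isomorphism. -/
def rPlaneEquiv (θ : Jet V W k) (s : JetExt θ) : rPlane θ s ≃ₗ[ℝ] V :=
  LinearEquiv.ofBijective ((LinearMap.fst ℝ V _).comp (rPlane θ s).subtype)
    ⟨fun X Y h => Subtype.ext (by
      rw [eq_rVec X.2, eq_rVec Y.2]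
      exact congrArg (rVec θ s) h), fun v => ⟨⟨rVec θ s v, rVec_mem θ s v⟩, rfl⟩⟩

lemma contract_ins_comm {r : ℕ} (s : SymForm V W (r + 1)) (v v' : V) :
    contract (ins s v) v' = contract (ins s v') v := by
  cases r with
  | zero => rfl
  | succ r =>
    change ins (ins s v) v' = ins (ins s v') v
    ext w
    rw [ins_apply, ins_apply, ins_apply, ins_apply]
    rw [← s.2 (Equiv.swap 0 1) (Fin.cons v (Fin.cons v' w))]
    congr 1
    funext i
    refine Fin.cases ?_ (fun i => Fin.cases ?_ (fun j => ?_) i) i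
    · simp
    · simp
    · have h1 : (j.succ.succ : Fin (r + 2)) ≠ 0 := Fin.succ_ne_zero _
      have h2 : (j.succ.succ : Fin (r + 2)) ≠ 1 := by
        rw [← Fin.succ_zero_eq_one]; exact fun h => Fin.succ_ne_zero _ (Fin.succ_injective _ h)
      simp [Equiv.swap_apply_of_ne_of_ne h1 h2]

lemma isotropic_rPlane (θ : Jet V W k) (s : JetExt θ) {X Y : Jet V W k} (hX : X ∈ rPlane θ s)
    (hY : Y ∈ rPlane θ s) : metasymplectic X Y = 0 := by
  rw [metasymplectic, hX.2, hY.2, contract_ins_comm, sub_self]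

lemma horizontal_rPlane (θ : Jet V W k) (s : JetExt θ) {X : Jet V W k} (hX : X ∈ rPlane θ s)
    (h : X.1 = 0) : X = 0 := by
  refine eq_of_mem_cartanPlane hX.1 (zero_mem _) h ?_
  rw [hX.2, h, ins_zero]; rfl

lemma isIntegralElement_rPlane (θ : Jet V W k) (s : JetExt θ) :
    IsIntegralElement θ (finrank ℝ V) (rPlane θ s) where
  le_cartan _ h := h.1
  finrank_eq := (rPlaneEquiv θ s).finrank_eq
  isotropic _ hX _ hY := isotropic_rPlane θ s hX hY
  horizontal _ hX h _ := horizontal_rPlane θ s hX h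

variable {l : ℕ}

lemma IsIntegralElement.eq_zero {θ : Jet V W k} {L : Submodule ℝ (Jet V W k)}
    (hL : IsIntegralElement θ l L) {X : Jet V W k} (hX : X ∈ L) (h : X.1 = 0) : X = 0 := by
  refine hL.horizontal X hX h fun r => ?_
  rw [hL.le_cartan hX r, h]
  exact ins_zero _

/-- The projection of a horizontal integral element to `V`, an isomorphism onto its image. -/
def IsIntegralElement.projEquiv {θ : Jet V W k} {L : Submodule ℝ (Jet V W k)}
    (hL : IsIntegralElement θ l L) : L ≃ₗ[ℝ] L.map (LinearMap.fst ℝ V _) :=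
  LinearEquiv.ofBijective ((LinearMap.fst ℝ V _).submoduleMap L)
    ⟨by
      rw [injective_iff_map_eq_zero]
      intro X hX
      exact Subtype.ext (hL.eq_zero X.2 (congrArg Subtype.val hX)),
      LinearMap.submoduleMap_surjective _ _⟩

/-- The direction `\underline L ⊂ V` of the flag `(L, R)`, the projection of `L` to the space `V`
of independent variables. -/
def Flag.dir {θ : Jet V W k} (F : Flag θ l) : Gr V l where
  plane := F.small.map (LinearMap.fst ℝ V _)
  finrank_eq := by rw [← F.small_mem.projEquiv.finrank_eq, F.small_mem.finrank_eq]

lemma symm_of_adjacent {r : ℕ} (f : V [×(r + 1)]→L[ℝ] W)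
    (h : ∀ (i : Fin r) (w : Fin (r + 1) → V), f (w ∘ Equiv.swap i.castSucc i.succ) = f w) :
    f ∈ symForms V W (r + 1) := by
  intro σ
  have hσ : σ ∈ Submonoid.closure
      (Set.range fun i : Fin r => Equiv.swap i.castSucc i.succ) := by
    rw [Equiv.Perm.mclosure_swap_castSucc_succ]; trivial
  induction hσ using Submonoid.closure_induction with
  | mem x hx => obtain ⟨i, rfl⟩ := hx; exact h i
  | one => intro w; rfl
  | mul x y _ _ hx hy =>
    intro w
    rw [← hx w, ← hy (w ∘ x)]
    rfl

lemma exists_topForm [FiniteDimensional ℝ V] {θ : Jet V W k} {R : Submodule ℝ (Jet V W k)}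
    (hR : IsIntegralElement θ (finrank ℝ V) R) : ∃ s : JetExt θ, R = rPlane θ s := by
  have htop : R.map (LinearMap.fst ℝ V ((r : Fin (k + 1)) → SymForm V W r)) = ⊤ := by
    apply Submodule.eq_top_of_finrank_eq
    rw [← hR.projEquiv.finrank_eq, hR.finrank_eq]
  let p : V ≃ₗ[ℝ] R := (hR.projEquiv ≪≫ₗ LinearEquiv.ofTop _ htop).symm
  have hp : ∀ v, (p v).1.1 = v := fun v => p.symm_apply_apply v
  have hp' : ∀ X (hX : X ∈ R), (p X.1).1 = X := fun X hX =>
    congrArg Subtype.val (p.apply_symm_apply ⟨X, hX⟩)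
  let A : V →ₗ[ℝ] (V [×k]→L[ℝ] W) :=
    { toFun := fun v => (topComp (p v).1).1
      map_add' := fun v v' => by rw [map_add]; rfl
      map_smul' := fun c v => by rw [map_smul]; rfl }
  let s : V [×(k + 1)]→L[ℝ] W := ContinuousLinearMap.uncurryLeft (LinearMap.toContinuousLinearMap A)
  have hs : ∀ v w, s (Fin.cons v w) = (topComp (p v).1).1 w := fun v w => rfl
  have hsym : s ∈ symForms V W (k + 1) := by
    apply symm_of_adjacent
    intro i w
    obtain ⟨k, rfl⟩ : ∃ k', k = k' + 1 := ⟨k - 1, by have := i.2; omega⟩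
    obtain ⟨v, w, rfl⟩ : ∃ v w', w = Fin.cons v w' := ⟨w 0, Fin.tail w, by simp⟩
    refine Fin.cases ?_ (fun j => ?_) i
    · obtain ⟨v', w, rfl⟩ : ∃ v w', w = Fin.cons v w' := ⟨w 0, Fin.tail w, by simp⟩
      have h1 := hR.isotropic _ (p v).2 _ (p v').2
      rw [metasymplectic, sub_eq_zero, hp, hp] at h1
      have h2 := congrArg (fun f : SymForm V W k => f.1 w) h1
      change (topComp (p v).1).1 (Fin.cons v' w) = (topComp (p v').1).1 (Fin.cons v w) at h2
      rw [← hs, ← hs] at h2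
      rw [h2]
      congr 1
      funext i
      refine Fin.cases ?_ (fun i => Fin.cases ?_ (fun j => ?_) i) i
      · simp
      · simp
      · have h1 : (j.succ.succ : Fin (k + 2)) ≠ 0 := Fin.succ_ne_zero _
        have h2 : (j.succ.succ : Fin (k + 2)) ≠ 1 := by
          rw [← Fin.succ_zero_eq_one]; exact fun h => Fin.succ_ne_zero _ (Fin.succ_injective _ h)
        simp [Equiv.swap_apply_of_ne_of_ne h1 h2]
    · have h1 := (topComp (p v).1).2 (Equiv.swap j.castSucc j.succ) w
      rw [← hs, ← hs] at h1
      rw [← h1]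
      congr 1
      funext i
      refine Fin.cases ?_ (fun i => ?_) i
      · rw [Function.comp_apply, Equiv.swap_apply_of_ne_of_ne]
        · rfl
        · rw [Fin.castSucc_succ]; exact (Fin.succ_ne_zero _).symm
        · exact (Fin.succ_ne_zero _).symm
      · rw [Fin.castSucc_succ, Function.comp_apply, Fin.cons_succ, Function.comp_apply]
        have h3 : Equiv.swap j.castSucc.succ j.succ.succ i.succ =
            (Equiv.swap j.castSucc j.succ i).succ :=
          ((Fin.succ_injective _).swap_apply _ _ _)
        rw [h3, Fin.cons_succ]
  have : Module.Finite ℝ (rPlane θ ⟨s, hsym⟩) := Module.Finite.equiv (rPlaneEquiv θ ⟨s, hsym⟩).symm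
  refine ⟨⟨s, hsym⟩, Submodule.eq_of_le_of_finrank_eq (fun X hX => ?_) ?_⟩
  · refine ⟨hR.le_cartan hX, ?_⟩
    ext w
    rw [ins_apply]
    change _ = s (Fin.cons X.1 w)
    rw [hs, hp' X hX]
  · rw [hR.finrank_eq, (isIntegralElement_rPlane θ _).finrank_eq]

lemma rPlane_injective (θ : Jet V W k) : Function.Injective (rPlane θ) := by
  intro s s' h
  have h1 : ∀ v, ins s v = ins s' v := fun v => by
    have h2 := rVec_mem θ s v
    rw [h] at h2
    rw [← topComp_rVec θ s v, h2.2]; rfl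
  ext w
  have h2 := congrArg (fun f : SymForm V W k => f.1 (Fin.tail w)) (h1 (w 0))
  simpa [ins_apply] using h2

section Flags

variable [FiniteDimensional ℝ V] {θ : Jet V W k}

/-- The projection `pr_n` of a flag `(L, R)` to the `(k+1)`-jet whose R-plane is `R`. -/
def Flag.jet (F : Flag θ l) : JetExt θ := (exists_topForm F.big_mem).choose

lemma Flag.big_eq (F : Flag θ l) : F.big = rPlane θ F.jet := (exists_topForm F.big_mem).choose_spec

/-- The flag with given direction and given `(k+1)`-jet. -/
def Flag.ofDirJet (D : Gr V l) (s : JetExt θ) : Flag θ l where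
  small := rPlane θ s ⊓ D.plane.comap (LinearMap.fst ℝ V _)
  big := rPlane θ s
  small_mem :=
    { le_cartan := fun _ hX => hX.1.1
      finrank_eq := by
        let j : V →ₗ[ℝ] Jet V W k := (rPlane θ s).subtype ∘ₗ (rPlaneEquiv θ s).symm.toLinearMap
        have hj : Function.Injective j :=
          (rPlane θ s).subtype_injective.comp (rPlaneEquiv θ s).symm.injective
        have h1 : ∀ X, (rPlaneEquiv θ s X) = X.1.1 := fun _ => rfl
        have h : rPlane θ s ⊓ D.plane.comap (LinearMap.fst ℝ V _) = D.plane.map j := by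
          ext X
          simp only [Submodule.mem_inf, Submodule.mem_comap, Submodule.mem_map]
          constructor
          · rintro ⟨hX, hX1⟩
            refine ⟨X.1, hX1, ?_⟩
            exact congrArg Subtype.val ((rPlaneEquiv θ s).symm_apply_apply ⟨X, hX⟩)
          · rintro ⟨v, hv, rfl⟩
            refine ⟨((rPlaneEquiv θ s).symm v).2, ?_⟩
            have := h1 ((rPlaneEquiv θ s).symm v)
            rw [LinearEquiv.apply_symm_apply] at this
            change (((rPlaneEquiv θ s).symm v).1).1 ∈ D.plane
            rwa [← this]
        rw [h, ← (Submodule.equivMapOfInjective j hj D.plane).finrank_eq, D.finrank_eq]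
      isotropic := fun _ hX _ hY => isotropic_rPlane θ s hX.1 hY.1
      horizontal := fun _ hX h _ => horizontal_rPlane θ s hX.1 h }
  big_mem := isIntegralElement_rPlane θ s
  small_le_big := inf_le_left

lemma Flag.dir_ofDirJet (D : Gr V l) (s : JetExt θ) : (Flag.ofDirJet D s).dir = D := by
  ext v
  simp only [Flag.dir, Flag.ofDirJet, Submodule.mem_map]
  constructor
  · rintro ⟨X, hX, rfl⟩
    exact hX.2
  · intro hv
    exact ⟨rVec θ s v, ⟨rVec_mem θ s v, hv⟩, rfl⟩

lemma Flag.jet_ofDirJet (D : Gr V l) (s : JetExt θ) : (Flag.ofDirJet D s).jet = s :=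
  rPlane_injective θ (Flag.big_eq (Flag.ofDirJet D s)).symm

lemma Flag.ofDirJet_dir_jet (F : Flag θ l) : Flag.ofDirJet F.dir F.jet = F := by
  have hb := F.big_eq
  refine Flag.ext ?_ hb.symm
  ext X
  constructor
  · rintro ⟨hX, Y, hY, hXY⟩
    have hY' : Y ∈ rPlane θ F.jet := by rw [← hb]; exact F.small_le_big hY
    have : X = Y := by
      rw [eq_rVec hX, eq_rVec hY']
      exact congrArg (rVec θ F.jet) hXY.symm
    rwa [this]
  · intro hX
    exact ⟨by rw [← hb]; exact F.small_le_big hX, X, hX, rfl⟩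

/-- The identification of the space of integral flags with `Gr(V, l) × J^{k+1}_θ`. -/
def flagEquiv (θ : Jet V W k) (l : ℕ) : Flag θ l ≃ Gr V l × JetExt θ where
  toFun F := (F.dir, F.jet)
  invFun q := Flag.ofDirJet q.1 q.2
  left_inv F := F.ofDirJet_dir_jet
  right_inv _ := Prod.ext (Flag.dir_ofDirJet _ _) (Flag.jet_ofDirJet _ _)

variable (V W) in
/-- The model space of the manifold of integral flags. -/
abbrev FlagModel (k l : ℕ) := GrModel V l × SymForm V W (k + 1)

/-- The parametrization of flags given by a frame of `V`. -/
def flagParam (θ : Jet V W k) (e : GrFrame V l) (a : FlagModel V W k l) : Flag θ l :=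
  Flag.ofDirJet (grGraph e a.1) a.2

lemma flagParam_eq_iff (e e' : GrFrame V l) (a b : FlagModel V W k l) :
    flagParam θ e a = flagParam θ e' b ↔ grGraph e a.1 = grGraph e' b.1 ∧ a.2 = b.2 := by
  constructor
  · intro h
    have h1 := congrArg Flag.dir h
    have h2 := congrArg Flag.jet h
    rw [flagParam, flagParam, Flag.dir_ofDirJet, Flag.dir_ofDirJet] at h1
    rw [flagParam, flagParam, Flag.jet_ofDirJet, Flag.jet_ofDirJet] at h2
    exact ⟨h1, h2⟩
  · rintro ⟨h1, h2⟩
    rw [flagParam, flagParam, h1, h2]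

lemma mem_range_flagParam_iff (e e' : GrFrame V l) (a : FlagModel V W k l) :
    flagParam θ e a ∈ Set.range (flagParam θ e') ↔ grGraph e a.1 ∈ Set.range (grGraph e') := by
  constructor
  · rintro ⟨b, hb⟩
    exact ⟨b.1, ((flagParam_eq_iff _ _ _ _).1 hb).1⟩
  · rintro ⟨B, hB⟩
    exact ⟨(B, a.2), (flagParam_eq_iff _ _ _ _).2 ⟨hB, rfl⟩⟩

/-- The smooth structure of `Gr(V, l) × J^{k+1}_θ` on the space of integral flags, given by the
affine coordinates of the Grassmannian and the linear coordinates of `S^{k+1} V^* ⊗ W`. -/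
def flagAtlas (θ : Jet V W k) (l : ℕ) :
    ParamAtlas (GrFrame V l) (FlagModel V W k l) (Flag θ l) where
  φ := flagParam θ
  inj e a b h := by
    obtain ⟨h1, h2⟩ := (flagParam_eq_iff _ _ _ _).1 h
    exact Prod.ext (grGraph_injective e h1) h2
  surj F := by
    obtain ⟨e, A, h⟩ := exists_grGraph F.dir
    refine ⟨e, (A, F.jet), ?_⟩
    change Flag.ofDirJet (grGraph e A) F.jet = F
    rw [h, F.ofDirJet_dir_jet]
  isOpen_overlap e e' := by
    simp only [mem_range_flagParam_iff]
    exact ((grAtlas V l).isOpen_overlap e e').preimage continuous_fst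
  exists_change e e' := by
    obtain ⟨τ, hτ, h⟩ := (grAtlas V l).exists_change e e'
    simp only [mem_range_flagParam_iff]
    refine ⟨fun a => (τ a.1, a.2), ?_, fun a ha => ?_⟩
    · exact (hτ.comp contDiffOn_fst fun a ha => ha).prodMk contDiffOn_snd
    · exact (flagParam_eq_iff _ _ _ _).2 ⟨h a.1 ha, rfl⟩

instance : TopologicalSpace (Flag θ l) := (flagAtlas θ l).core.toTopologicalSpace

instance : ChartedSpace (FlagModel V W k l) (Flag θ l) := (flagAtlas θ l).core.toChartedSpace

instance : IsManifold 𝓘(ℝ, FlagModel V W k l) ∞ (Flag θ l) := (flagAtlas θ l).isManifold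

/-! ### The higher vertical distributions and the higher flag distributions -/

/-- The symmetric forms that vanish as soon as `p` of their arguments lie in `D`, i.e. the
homogeneous polynomials that vanish after `p` derivatives in directions of `D`. -/
def muFilt (r p : ℕ) (D : Submodule ℝ V) : Submodule ℝ (SymForm V W r) where
  carrier := {f | ∀ S : Finset (Fin r), S.card = p → ∀ w : Fin r → V, (∀ i ∈ S, w i ∈ D) →
    f.1 w = 0}
  add_mem' hf hg S hS w hw := by simp [hf S hS w hw, hg S hS w hw]
  zero_mem' S hS w hw := by simp
  smul_mem' c f hf S hS w hw := by simp [hf S hS w hw]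

/-- The differential at `F` of the projection `(L, R) ↦ \underline L` to the Grassmannian. -/
def dDir (F : Flag θ l) :
    TangentSpace 𝓘(ℝ, FlagModel V W k l) F →L[ℝ] TangentSpace 𝓘(ℝ, GrModel V l) F.dir :=
  mfderiv 𝓘(ℝ, FlagModel V W k l) 𝓘(ℝ, GrModel V l) Flag.dir F

/-- The differential at `F` of `pr_n : (L, R) ↦ θ_{k+1}`; the tangent spaces of the affine space
`J^{k+1}_θ` are identified with `S^{k+1} V^* ⊗ W`. -/
def dJet (F : Flag θ l) :
    TangentSpace 𝓘(ℝ, FlagModel V W k l) F →L[ℝ] SymForm V W (k + 1) :=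
  mfderiv 𝓘(ℝ, FlagModel V W k l) 𝓘(ℝ, SymForm V W (k + 1)) Flag.jet F

/-- The vertical distribution of `pr_n`. -/
def vertJet (θ : Jet V W k) (l : ℕ) : Distribution (FlagModel V W k l) (Flag θ l) :=
  fun F => LinearMap.ker (dJet F).toLinearMap

/-- The `p`-th higher vertical distribution `V^p`: the vectors `0 ⊕ f` of
`T_{(L,R)} = T Gr(V, l) ⊕ S^{k+1} V^* ⊗ W` such that the polynomial `f` vanishes after `p`
derivatives along `\underline L`. -/
def vertDist (θ : Jet V W k) (l p : ℕ) : Distribution (FlagModel V W k l) (Flag θ l) :=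
  fun F => LinearMap.ker (dDir F).toLinearMap ⊓
    (muFilt (k + 1) p F.dir.plane).comap (dJet F).toLinearMap

/-- The `p`-th higher flag distribution `F^p = V^{p+1} + V pr_n`. -/
def flagDist (θ : Jet V W k) (l p : ℕ) : Distribution (FlagModel V W k l) (Flag θ l) :=
  fun F => vertDist θ l (p + 1) F ⊔ vertJet θ l F

end Flags

end Jets

end FlagJets

end

noncomputable section
namespace FlagJets

/-! ### Transport of distributions, sections and brackets along local diffeomorphisms. -/

section LocalDiffeo

variable {E : Type*} [NormedAddCommGroup E] [NormedSpace ℝ E]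
  {M : Type*} [TopologicalSpace M] [ChartedSpace E M]
  {E' : Type*} [NormedAddCommGroup E'] [NormedSpace ℝ E']
  {M' : Type*} [TopologicalSpace M'] [ChartedSpace E' M']

/-! Everything is computed in coordinates that straighten the direction of the flag. Near a given
plane the directions are the graphs `y = A x` in a splitting `V = X × Y`, with `A` in `Hom(X, Y)`.
Instead of the form `f` itself, use the form `t` on `X × Y` whose pullback under the coordinates
that carry the graph of `A` to `X` is `f`. In the coordinates `(A, t)` the filtration `μ^p` no
longer depends on the point, so `V^p` is the constant distribution `0 × μ^p`. The price is that the
condition `f' = 0` becomes `t' = N_B t`, where `B = A'` and `N_B` is the derivation of symmetric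
forms induced by the nilpotent map `(x, y) ↦ (0, B x)` (`fderiv_pull_shear`). Hence `F^p` is given
by `t' - N_B t ∈ μ^(p+1)` (`corresponds_flagDist`).

The operators `N_B` commute, so for sections `X = (B, N_B t + m)` and `Y = (C, N_C t + m')`, with
`m`, `m'` in `μ^(p+1)`, the bracket lies in `F^p` exactly when `N_C m - N_B m' ∈ μ^(p+1)`
(`mlieBracket_mem_shearDist`). A characteristic vector must satisfy this for all `C` and `m'`. With
`C = 0` it says that `N_B` preserves `μ^(p+1)`, which for `p ≤ k` forces `B = 0`
(`eq_zero_of_derivSym_mem`, tested on the monomial `α^p β^(k+1-p)`). What remains, `N_C m ∈ μ^(p+1)`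
for all `C`, forces `m ∈ μ^p` (`mem_muFilt_of_derivSym_mem`). Conversely `N_C` maps `μ^p` to
`μ^(p+1)` (`derivSym_mem_muFilt`), so constant fields in `0 × μ^p` are characteristic. For `p = k +
1` the space `μ^(p+1)` is everything and there is nothing to compute.

For the leaf space, each adapted parametrization is defined on a whole vector space, contains every
leaf that it meets, and shows the leaves as translates of `0 × μ^p`. The linear quotients by `0 ×
μ^p` therefore parametrize the leaf space and give its smooth structure (`FoliatedAtlas`). The plane
`{t' - N_B t ∈ μ^(p+1)}` contains `0 × μ^p` and does not change along a leaf, so `F^p` passes to the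
quotient (`mem_shearImage`). -/

lemma minSmoothness_two_le_infty : minSmoothness ℝ 2 ≤ ∞ := by
  rw [minSmoothness_of_isRCLikeNormedField]
  exact WithTop.coe_le_coe.2 (le_top : (2 : ℕ∞) ≤ ⊤)

/-- A homeomorphism between open subsets of two manifolds that is smooth in both directions. -/
structure IsLocalDiffeo (f : OpenPartialHomeomorph M M') : Prop where
  contMDiffOn : ContMDiffOn 𝓘(ℝ, E) 𝓘(ℝ, E') ∞ f f.source
  contMDiffOn_symm : ContMDiffOn 𝓘(ℝ, E') 𝓘(ℝ, E) ∞ f.symm f.target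

/-- The distributions `D` and `D'` correspond to each other under `f`. -/
def Corresponds (f : OpenPartialHomeomorph M M') (D : Distribution E M)
    (D' : Distribution E' M') : Prop :=
  ∀ x ∈ f.source, ∀ v : TangentSpace 𝓘(ℝ, E) x,
    v ∈ D x ↔ mfderiv 𝓘(ℝ, E) 𝓘(ℝ, E') f x v ∈ D' (f x)

namespace IsLocalDiffeo

variable {f : OpenPartialHomeomorph M M'} (hf : IsLocalDiffeo (E := E) (E' := E') f)

include hf

lemma symm : IsLocalDiffeo (E := E') (E' := E) f.symm :=
  ⟨hf.contMDiffOn_symm, hf.contMDiffOn⟩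

lemma mdifferentiable : f.MDifferentiable 𝓘(ℝ, E) 𝓘(ℝ, E') :=
  ⟨hf.contMDiffOn.mdifferentiableOn (by simp), hf.contMDiffOn_symm.mdifferentiableOn (by simp)⟩

lemma contMDiffAt {x : M} (hx : x ∈ f.source) : ContMDiffAt 𝓘(ℝ, E) 𝓘(ℝ, E') ∞ f x :=
  hf.contMDiffOn.contMDiffAt (f.open_source.mem_nhds hx)

lemma mfderiv_symm_apply {x : M} (hx : x ∈ f.source) (v : TangentSpace 𝓘(ℝ, E) x) :
    mfderiv 𝓘(ℝ, E') 𝓘(ℝ, E) f.symm (f x) (mfderiv 𝓘(ℝ, E) 𝓘(ℝ, E') f x v) = v :=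
  DFunLike.congr_fun (hf.mdifferentiable.symm_comp_deriv hx) v

lemma mfderiv_apply_symm {x : M} (hx : x ∈ f.source) (v : TangentSpace 𝓘(ℝ, E') (f x)) :
    mfderiv 𝓘(ℝ, E) 𝓘(ℝ, E') f x (mfderiv 𝓘(ℝ, E') 𝓘(ℝ, E) f.symm (f x) v) = v := by
  have h := hf.mdifferentiable.comp_symm_deriv (f.map_source hx)
  rw [f.left_inv hx] at h
  exact DFunLike.congr_fun h v

lemma isInvertible {x : M} (hx : x ∈ f.source) :
    (mfderiv 𝓘(ℝ, E) 𝓘(ℝ, E') f x).IsInvertible :=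
  ⟨hf.mdifferentiable.mfderiv hx, rfl⟩

lemma mpullback_apply_eq {X : VField E' M'} {x : M} (hx : x ∈ f.source) :
    mfderiv 𝓘(ℝ, E) 𝓘(ℝ, E') f x (VectorField.mpullback 𝓘(ℝ, E) 𝓘(ℝ, E') f X x) = X (f x) :=
  (hf.isInvertible hx).self_apply_inverse _

omit hf in
-- Tangent spaces at all points are definitionally the model space `E`, so values over
-- propositionally equal base points can be compared there. This is needed because `f.symm (f x)` is
-- only propositionally `x`.
lemma vfield_congr (X : VField E M) {x y : M} (h : y = x) : (X y : E) = X x := by subst h; rfl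

omit hf in
lemma distribution_congr (D : Distribution E M) {x y : M} (h : y = x) (v : E) :
    (v : TangentSpace 𝓘(ℝ, E) y) ∈ D y ↔ (v : TangentSpace 𝓘(ℝ, E) x) ∈ D x := by
  subst h; rfl

lemma mpullback_symm_apply {X : VField E M} {x : M} (hx : x ∈ f.source) :
    VectorField.mpullback 𝓘(ℝ, E') 𝓘(ℝ, E) f.symm X (f x) =
      mfderiv 𝓘(ℝ, E) 𝓘(ℝ, E') f x (X x) := by
  have h := hf.symm.mpullback_apply_eq (X := X) (f.map_source hx)
  have h2 := congrArg (fun v : E => mfderiv 𝓘(ℝ, E) 𝓘(ℝ, E') f x v) h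
  have h3 := hf.mfderiv_apply_symm hx (VectorField.mpullback 𝓘(ℝ, E') 𝓘(ℝ, E) f.symm X (f x))
  refine h3.symm.trans (h2.trans ?_)
  exact congrArg (fun v : E => mfderiv 𝓘(ℝ, E) 𝓘(ℝ, E') f x v) (vfield_congr X (f.left_inv hx))

lemma mpullback_mpullback_symm {X : VField E M} {x : M} (hx : x ∈ f.source) :
    VectorField.mpullback 𝓘(ℝ, E) 𝓘(ℝ, E') f
      (VectorField.mpullback 𝓘(ℝ, E') 𝓘(ℝ, E) f.symm X) x = X x := by
  rw [VectorField.mpullback_apply, hf.mpullback_symm_apply hx]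
  exact (hf.isInvertible hx).inverse_apply_self _

lemma corresponds_symm {D : Distribution E M} {D' : Distribution E' M'}
    (h : Corresponds f D D') : Corresponds f.symm D' D := by
  intro y hy v
  obtain ⟨x, hx, rfl⟩ : ∃ x ∈ f.source, f x = y := ⟨f.symm y, f.map_target hy, f.right_inv hy⟩
  refine Iff.trans ?_ (distribution_congr D (f.left_inv hx) _).symm
  refine Iff.trans (Iff.of_eq ?_)
    (h x hx (mfderiv 𝓘(ℝ, E') 𝓘(ℝ, E) f.symm (f x) v : E)).symm
  exact congrArg (· ∈ D' (f x)) (hf.mfderiv_apply_symm hx v).symm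

variable [IsManifold 𝓘(ℝ, E) ∞ M] [IsManifold 𝓘(ℝ, E') ∞ M'] [CompleteSpace E]

lemma smoothOn_mpullback {X : VField E' M'} {U : Set M'} (hX : SmoothOn X U) :
    SmoothOn (VectorField.mpullback 𝓘(ℝ, E) 𝓘(ℝ, E') f X) (f.source ∩ f ⁻¹' U) := by
  have : IsManifold 𝓘(ℝ, E) 1 M := IsManifold.of_le (n := ∞) (by simp)
  have : IsManifold 𝓘(ℝ, E') 1 M' := IsManifold.of_le (n := ∞) (by simp)
  have : IsManifold 𝓘(ℝ, E) (∞ + 1) M := by simpa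
  have : IsManifold 𝓘(ℝ, E') (∞ + 1) M' := by simpa
  intro x hx
  exact (ContMDiffWithinAt.mpullback_vectorField_preimage (n := ∞) (hX _ hx.2)
    (hf.contMDiffAt hx.1) (hf.isInvertible hx.1) (by simp)).mono inter_subset_right

/-- The pullback of a local frame is a local frame, since the differential is invertible. -/
lemma exists_frame {D : Distribution E M} {D' : Distribution E' M'} (h : Corresponds f D D')
    (hD' : IsSmoothDistribution D') {x : M} (hx : x ∈ f.source) :
    ∃ U : Set M, IsOpen U ∧ x ∈ U ∧ ∃ (r : ℕ) (X : Fin r → VField E M),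
      (∀ i, SmoothOn (X i) U) ∧
      ∀ y ∈ U, LinearIndependent ℝ (fun i => X i y) ∧
        Submodule.span ℝ (Set.range fun i => X i y) = D y := by
  obtain ⟨U, hU, hxU, r, X, hX, h1⟩ := hD' (f x)
  refine ⟨f.source ∩ f ⁻¹' U, f.isOpen_inter_preimage hU, ⟨hx, hxU⟩, r,
    fun i => VectorField.mpullback 𝓘(ℝ, E) 𝓘(ℝ, E') f (X i),
    fun i => hf.smoothOn_mpullback (hX i), fun y hy => ?_⟩
  obtain ⟨hli, hsp⟩ := h1 _ hy.2
  set L := hf.mdifferentiable.mfderiv hy.1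
  have hL : ∀ i, VectorField.mpullback 𝓘(ℝ, E) 𝓘(ℝ, E') f (X i) y = L.symm (X i (f y)) := by
    intro i
    rw [← hf.mpullback_apply_eq (X := X i) hy.1]
    exact (L.symm_apply_apply _).symm
  simp only [hL]
  refine ⟨hli.map' L.symm.toLinearEquiv.toLinearMap L.symm.toLinearEquiv.ker, ?_⟩
  have h2 : (range fun i => L.symm (X i (f y))) =
      L.symm.toLinearEquiv.toLinearMap '' range fun i => X i (f y) := by
    rw [← range_comp]; rfl
  rw [h2, Submodule.span_image, hsp]
  ext v
  rw [h y hy.1]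
  constructor
  · rintro ⟨w, hw, rfl⟩
    have : L (L.symm w) = w := L.apply_symm_apply w
    exact this.symm ▸ hw
  · intro hv
    exact ⟨_, hv, L.symm_apply_apply v⟩

lemma isSectionOn_mpullback {D : Distribution E M} {D' : Distribution E' M'}
    (h : Corresponds f D D') {X : VField E' M'} {U : Set M'} (hX : IsSectionOn D' U X) :
    IsSectionOn D (f.source ∩ f ⁻¹' U) (VectorField.mpullback 𝓘(ℝ, E) 𝓘(ℝ, E') f X) := by
  refine ⟨hf.smoothOn_mpullback hX.1, fun x hx => ?_⟩
  rw [h x hx.1, hf.mpullback_apply_eq hx.1]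
  exact hX.2 _ hx.2

omit hf [CompleteSpace E] in
lemma mdifferentiableAt_of_smoothOn [IsManifold 𝓘(ℝ, E) 1 M] {X : VField E M} {U : Set M}
    (hU : IsOpen U) (hX : SmoothOn X U) {x : M} (hx : x ∈ U) :
    MDifferentiableAt 𝓘(ℝ, E) 𝓘(ℝ, E).tangent
      (fun x => (⟨x, X x⟩ : TangentBundle 𝓘(ℝ, E) M)) x :=
  (ContMDiffOn.contMDiffAt hX (hU.mem_nhds hx)).mdifferentiableAt (by simp)

lemma mlieBracket_mpullback {X Y : VField E' M'} {U : Set M'} (hU : IsOpen U)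
    (hX : SmoothOn X U) (hY : SmoothOn Y U) {x : M} (hx : x ∈ f.source) (hxU : f x ∈ U) :
    VectorField.mpullback 𝓘(ℝ, E) 𝓘(ℝ, E') f (VectorField.mlieBracket 𝓘(ℝ, E') X Y) x =
      VectorField.mlieBracket 𝓘(ℝ, E) (VectorField.mpullback 𝓘(ℝ, E) 𝓘(ℝ, E') f X)
        (VectorField.mpullback 𝓘(ℝ, E) 𝓘(ℝ, E') f Y) x := by
  have : IsManifold 𝓘(ℝ, E') 1 M' := IsManifold.of_le (n := ∞) (by simp)
  have : IsManifold 𝓘(ℝ, E) (minSmoothness ℝ 2) M :=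
    IsManifold.of_le minSmoothness_two_le_infty
  have : IsManifold 𝓘(ℝ, E') (minSmoothness ℝ 2) M' :=
    IsManifold.of_le minSmoothness_two_le_infty
  exact VectorField.mpullback_mlieBracket (n := ∞) (mdifferentiableAt_of_smoothOn hU hX hxU)
    (mdifferentiableAt_of_smoothOn hU hY hxU) (hf.contMDiffAt hx) minSmoothness_two_le_infty

variable [CompleteSpace E']

/-- A test section on the source is pushed forward, bracketed there, and the result pulled back;
naturality of the Lie bracket does the rest. -/
lemma isCharSymmetryOn_mpullback {D : Distribution E M} {D' : Distribution E' M'}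
    (h : Corresponds f D D') {X : VField E' M'} {U : Set M'}
    (hX : IsCharSymmetryOn D' U X) :
    IsCharSymmetryOn D (f.source ∩ f ⁻¹' U) (VectorField.mpullback 𝓘(ℝ, E) 𝓘(ℝ, E') f X) := by
  refine ⟨hf.isSectionOn_mpullback h hX.1, fun U' hU' hoU' Y hY x hx => ?_⟩
  have hxs := (hU' hx).1
  set Y' := VectorField.mpullback 𝓘(ℝ, E') 𝓘(ℝ, E) f.symm Y with hY'
  have hsec : IsSectionOn D' (f.target ∩ f.symm ⁻¹' U') Y' :=
    hf.symm.isSectionOn_mpullback (hf.corresponds_symm h) hY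
  have ho : IsOpen (f.target ∩ f.symm ⁻¹' U') := f.isOpen_inter_preimage_symm hoU'
  have hsub : f.target ∩ f.symm ⁻¹' U' ⊆ U := by
    rintro y ⟨hy, hy'⟩
    have := (hU' hy').2
    rwa [mem_preimage, f.right_inv hy] at this
  have hfx : f x ∈ f.target ∩ f.symm ⁻¹' U' := by
    refine ⟨f.map_source hxs, ?_⟩
    rwa [mem_preimage, f.left_inv hxs]
  have h1 := hX.2 _ hsub ho Y' hsec (f x) hfx
  -- Pushing `Y` forward and back returns `Y` only on the source of `f`, which suffices because the
  -- bracket at `x` depends on germs.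
  have h2 : VectorField.mlieBracket 𝓘(ℝ, E) (VectorField.mpullback 𝓘(ℝ, E) 𝓘(ℝ, E') f X) Y x =
      VectorField.mlieBracket 𝓘(ℝ, E) (VectorField.mpullback 𝓘(ℝ, E) 𝓘(ℝ, E') f X)
        (VectorField.mpullback 𝓘(ℝ, E) 𝓘(ℝ, E') f Y') x := by
    refine Filter.EventuallyEq.mlieBracket_vectorField_eq Filter.EventuallyEq.rfl ?_
    filter_upwards [f.open_source.mem_nhds hxs] with z hz
    exact (hf.mpullback_mpullback_symm hz).symm
  rw [h2, ← hf.mlieBracket_mpullback ho (fun y hy => (hX.1.1 y (hsub hy)).mono hsub) hsec.1 hxs hfx,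
    h x hxs, hf.mpullback_apply_eq hxs]
  exact h1

lemma mfderiv_mem_charDistribution {D : Distribution E M} {D' : Distribution E' M'}
    (h : Corresponds f D D') {x : M} (hx : x ∈ f.source) {v : TangentSpace 𝓘(ℝ, E) x}
    (hv : v ∈ charDistribution D x) :
    mfderiv 𝓘(ℝ, E) 𝓘(ℝ, E') f x v ∈ charDistribution D' (f x) := by
  rw [charDistribution] at hv
  induction hv using Submodule.span_induction with
  | mem v hv =>
    obtain ⟨U, X, hU, hxU, hX, rfl⟩ := hv
    refine Submodule.subset_span ⟨_, _, f.isOpen_inter_preimage_symm hU, ⟨f.map_source hx, ?_⟩,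
      hf.symm.isCharSymmetryOn_mpullback (hf.corresponds_symm h) hX,
      hf.mpullback_symm_apply hx⟩
    rwa [mem_preimage, f.left_inv hx]
  | zero => rw [map_zero]; exact zero_mem _
  | add v w _ _ hv hw => rw [map_add]; exact add_mem hv hw
  | smul c v _ hv => rw [map_smul]; exact Submodule.smul_mem _ _ hv

lemma corresponds_charDistribution {D : Distribution E M} {D' : Distribution E' M'}
    (h : Corresponds f D D') : Corresponds f (charDistribution D) (charDistribution D') := by
  refine fun x hx v => ⟨hf.mfderiv_mem_charDistribution h hx, fun hv => ?_⟩
  have h1 := hf.symm.mfderiv_mem_charDistribution (hf.corresponds_symm h) (f.map_source hx) hv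
  have h2 := (distribution_congr (charDistribution D) (f.left_inv hx) _).1 h1
  rwa [show (mfderiv 𝓘(ℝ, E') 𝓘(ℝ, E) f.symm (f x) (mfderiv 𝓘(ℝ, E) 𝓘(ℝ, E') f x v) : E) = v
    from hf.mfderiv_symm_apply hx v] at h2

end IsLocalDiffeo

end LocalDiffeo

/-! ### The model distribution `t' - N_B t ∈ μ` and its characteristic distribution. -/

section Shear

lemma exists_clm_ker_eq {T : Type*} [NormedAddCommGroup T] [NormedSpace ℝ T]
    [FiniteDimensional ℝ T] (μ : Submodule ℝ T) :
    ∃ (d : ℕ) (q : T →L[ℝ] (Fin d → ℝ)), Function.Surjective q ∧ ∀ t, q t = 0 ↔ t ∈ μ := by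
  let e : (T ⧸ μ) ≃ₗ[ℝ] (Fin (finrank ℝ (T ⧸ μ)) → ℝ) :=
    LinearEquiv.ofFinrankEq _ _ (by simp)
  refine ⟨_, LinearMap.toContinuousLinearMap (e.toLinearMap ∘ₗ μ.mkQ), ?_, fun t => ?_⟩
  · exact e.surjective.comp μ.mkQ_surjective
  · simp

/-- Compose with a linear map whose kernel is `μ`: the composite vanishes near `a`, hence so does
its derivative. -/
lemma fderiv_mem_of_eventually_mem {F T : Type*} [NormedAddCommGroup F] [NormedSpace ℝ F]
    [NormedAddCommGroup T] [NormedSpace ℝ T] [FiniteDimensional ℝ T] {μ : Submodule ℝ T}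
    {g : F → T} {g' : F →L[ℝ] T} {a : F} (hg : HasFDerivAt g g' a)
    (h : ∀ᶠ y in 𝓝 a, g y ∈ μ) (w : F) : g' w ∈ μ := by
  obtain ⟨d, q, -, hq⟩ := exists_clm_ker_eq μ
  have h1 : HasFDerivAt (fun y => q (g y)) (q ∘L g') a := q.hasFDerivAt.comp a hg
  have h2 : HasFDerivAt (fun y => q (g y)) (0 : F →L[ℝ] (Fin d → ℝ)) a :=
    (hasFDerivAt_const (0 : Fin d → ℝ) a).congr_of_eventuallyEq
      (h.mono fun y hy => (hq _).2 hy)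
  rw [← hq]
  exact DFunLike.congr_fun (h1.unique h2) w

variable {A T : Type*} [NormedAddCommGroup A] [NormedSpace ℝ A] [NormedAddCommGroup T]
  [NormedSpace ℝ T]

/-- The distribution `{(B, t') | t' - N_B t ∈ μ}` at the point `(A, t)`. -/
def shearDist (N : A →L[ℝ] T →L[ℝ] T) (μ : Submodule ℝ T) : Distribution (A × T) (A × T) :=
  fun a => μ.comap (LinearMap.snd ℝ A T - (N.flip a.2).toLinearMap ∘ₗ LinearMap.fst ℝ A T)

/-- The distribution `0 × μ`. -/
def fiberDist (A : Type*) [NormedAddCommGroup A] [NormedSpace ℝ A] (μ : Submodule ℝ T) :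
    Distribution (A × T) (A × T) :=
  fun _ => (⊥ : Submodule ℝ A).prod μ

variable {N : A →L[ℝ] T →L[ℝ] T} {μ μ₀ : Submodule ℝ T}

lemma mem_shearDist {a v : A × T} : v ∈ shearDist N μ a ↔ v.2 - N v.1 a.2 ∈ μ := Iff.rfl

lemma mem_fiberDist {a v : A × T} : v ∈ fiberDist A μ a ↔ v.1 = 0 ∧ v.2 ∈ μ := Iff.rfl

lemma mlieBracket_eq_lieBracket (X Y : VField A A) (a : A) :
    VectorField.mlieBracket 𝓘(ℝ, A) X Y a = VectorField.lieBracket ℝ X Y a := by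
  rw [← VectorField.mlieBracketWithin_univ, VectorField.mlieBracketWithin_eq_lieBracketWithin]
  exact congrFun (VectorField.lieBracketWithin_univ (𝕜 := ℝ) (V := X) (W := Y)) a

variable [FiniteDimensional ℝ T]

/-- This is the derivative of the defining relation `X.2 - N X.1 t ∈ μ` in the direction `w`. -/
lemma fderiv_section_shearDist {X : A × T → A × T} {a : A × T} (hX : DifferentiableAt ℝ X a)
    (h : ∀ᶠ y in 𝓝 a, X y ∈ shearDist N μ y) (w : A × T) :
    (fderiv ℝ X a w).2 - N (fderiv ℝ X a w).1 a.2 - N (X a).1 w.2 ∈ μ := by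
  have h1 := hX.hasFDerivAt.snd.sub
    ((N.hasFDerivAt.comp a hX.hasFDerivAt.fst).clm_apply (hasFDerivAt_snd (p := a)))
  have h2 := fderiv_mem_of_eventually_mem h1 h w
  convert h2 using 1
  simp
  abel

/-- The derivatives of the two sections along each other cancel modulo `μ`, leaving `N Y.1 X.2 - N
X.1 Y.2`. Since the operators commute, `X.2` and `Y.2` may be replaced by their components in `μ`,
which gives the curvature of the distribution. -/
lemma mlieBracket_mem_shearDist (hN : ∀ B C t, N B (N C t) = N C (N B t))
    {X Y : A × T → A × T} {a : A × T}
    (hX : DifferentiableAt ℝ X a) (hY : DifferentiableAt ℝ Y a)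
    (hXs : ∀ᶠ y in 𝓝 a, X y ∈ shearDist N μ y) (hYs : ∀ᶠ y in 𝓝 a, Y y ∈ shearDist N μ y) :
    VectorField.mlieBracket 𝓘(ℝ, A × T) X Y a ∈ shearDist N μ a ↔
      N (Y a).1 ((X a).2 - N (X a).1 a.2) - N (X a).1 ((Y a).2 - N (Y a).1 a.2) ∈ μ := by
  have h1 := fderiv_section_shearDist hX hXs (Y a)
  have h2 := fderiv_section_shearDist hY hYs (X a)
  have h3 := sub_mem h2 h1
  refine (Iff.of_eq (congrArg (· ∈ shearDist N μ a) (mlieBracket_eq_lieBracket X Y a))).trans ?_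
  refine mem_shearDist.trans ?_
  rw [VectorField.lieBracket, Prod.fst_sub, Prod.snd_sub, map_sub,
    sub_apply]
  rw [map_sub, map_sub, hN (Y a).1]
  constructor
  · intro h
    convert sub_mem h h3 using 1
    abel
  · intro h
    convert add_mem h h3 using 1
    abel

omit [FiniteDimensional ℝ T] in
lemma isSectionOn_iff {D : Distribution (A × T) (A × T)} {U : Set (A × T)}
    {X : A × T → A × T} :
    IsSectionOn D U X ↔ ContDiffOn ℝ ∞ X U ∧ ∀ y ∈ U, X y ∈ D y :=
  and_congr_left fun _ => contMDiffOn_vectorSpace_iff_contDiffOn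

/-- The hypotheses `h0`, `h1`, `h2` say exactly that the kernel of the curvature is `0 × μ₀`. -/
theorem charDistribution_shearDist (hN : ∀ B C t, N B (N C t) = N C (N B t)) (hμ : μ₀ ≤ μ)
    (h0 : ∀ B, ∀ m ∈ μ₀, N B m ∈ μ) (h1 : ∀ m ∈ μ, (∀ B, N B m ∈ μ) → m ∈ μ₀)
    (h2 : ∀ B, (∀ m ∈ μ, N B m ∈ μ) → B = 0) :
    charDistribution (shearDist N μ) = fiberDist A μ₀ := by
  funext a
  apply le_antisymm
  · refine Submodule.span_le.2 ?_
    rintro v ⟨U, X, hU, ha, hX, rfl⟩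
    have hXs := isSectionOn_iff.1 hX.1
    have key : ∀ B, ∀ m ∈ μ, N B ((X a : A × T).2 - N (X a : A × T).1 a.2) -
        N (X a : A × T).1 m ∈ μ := by
      intro B m hm
      -- These sections realize every pair of a first component `B` and a component `m` in `μ`, so
      -- testing against them is enough.
      let Y : A × T → A × T := fun y => (B, N B y.2 + m)
      have hY : ContDiff ℝ ∞ Y :=
        contDiff_const.prodMk (((N B).contDiff.comp contDiff_snd).add contDiff_const)
      have hYs : ∀ y, Y y ∈ shearDist N μ y := fun y => by
        rw [mem_shearDist]; simpa [Y] using hm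
      have h3 := hX.2 U subset_rfl hU Y (isSectionOn_iff.2 ⟨hY.contDiffOn, fun y _ => hYs y⟩) a ha
      have h4 := (mlieBracket_mem_shearDist hN
        ((hXs.1.contDiffAt (hU.mem_nhds ha)).differentiableAt (by simp))
        (hY.contDiffAt.differentiableAt (by simp))
        (Filter.mem_of_superset (hU.mem_nhds ha) hXs.2)
        (Filter.Eventually.of_forall hYs)).1 h3
      simpa [Y] using h4
    -- Testing with `B = 0` isolates the operator of the first component of `X`; below, `m = 0`
    -- isolates its part in `μ`.
    have hX1 : (X a : A × T).1 = 0 := h2 _ fun m hm => by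
      simpa using key 0 m hm
    have hm : (X a : A × T).2 ∈ μ := by
      have := mem_shearDist.1 (hXs.2 a ha)
      rw [hX1] at this
      simpa using this
    refine mem_fiberDist.2 ⟨hX1, h1 _ hm fun B => ?_⟩
    simpa [hX1] using key B 0 (zero_mem _)
  · rintro ⟨B, m⟩ hv
    obtain ⟨rfl, hm⟩ := mem_fiberDist.1 hv
    refine Submodule.subset_span ⟨univ, fun _ => ((0, m) : A × T), isOpen_univ, mem_univ _,
      ⟨isSectionOn_iff.2 ⟨contDiffOn_const, fun y _ => ?_⟩, ?_⟩, rfl⟩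
    · rw [mem_shearDist]
      simpa using hμ hm
    · intro U' _ hU' Y hY y hy
      have hYs := isSectionOn_iff.1 hY
      refine (mlieBracket_mem_shearDist hN (differentiableAt_const _)
        ((hYs.1.contDiffAt (hU'.mem_nhds hy)).differentiableAt (by simp))
        (Filter.Eventually.of_forall fun y => ?_)
        (Filter.mem_of_superset (hU'.mem_nhds hy) hYs.2)).2 ?_
      · rw [mem_shearDist]
        simpa using hμ hm
      · simpa using h0 _ m hm

omit [FiniteDimensional ℝ T] in
theorem charDistribution_top :
    charDistribution (fun _ => ⊤ : Distribution A A) = fun _ => ⊤ := by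
  funext a
  rw [eq_top_iff]
  intro v _
  exact Submodule.subset_span ⟨univ, fun _ => v, isOpen_univ, mem_univ _,
    ⟨⟨contMDiffOn_vectorSpace_iff_contDiffOn.2 contDiffOn_const, fun _ _ => trivial⟩,
      fun _ _ _ _ _ _ _ => trivial⟩, rfl⟩

end Shear

/-! ### Smooth structure on the leaf space, and descent of a distribution to it. -/

section LeafSpaces

variable {E : Type*} [NormedAddCommGroup E] [NormedSpace ℝ E]
  {M : Type*} [TopologicalSpace M] [ChartedSpace E M]
  {ι F B : Type*} [NormedAddCommGroup F] [NormedSpace ℝ F]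
  [NormedAddCommGroup B] [NormedSpace ℝ B]

variable (ι F B) in
/-- A family of parametrizations of `M` by `F` in which the distribution `K` is the constant
distribution `ker π` and the classes of `r` are the fibres of the linear map `π`. -/
structure FoliatedAtlas (K : Distribution E M) (r : Setoid M) where
  param : ι → OpenPartialHomeomorph F M
  π : F →L[ℝ] B
  σ : B →L[ℝ] F
  π_σ : ∀ b, π (σ b) = b
  source_eq : ∀ i, (param i).source = univ
  isLocalDiffeo : ∀ i, IsLocalDiffeo (E := F) (E' := E) (param i)
  cover : ∀ x, ∃ i a, param i a = x
  corresponds : ∀ i, Corresponds (param i) (fun _ => LinearMap.ker π.toLinearMap) K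
  saturated : ∀ i a y, r (param i a) y → ∃ b, param i b = y
  rel_iff : ∀ i a b, r (param i a) (param i b) ↔ π a = π b

/-- Read in the parametrization, the curve has velocity in `ker π`, so `π` of it has zero derivative
on an interval around `s`. -/
lemma eq_of_mfderiv_mem_ker [CompleteSpace F] {π : F →L[ℝ] B} {K : Distribution E M}
    {f : OpenPartialHomeomorph F M} (hf : IsLocalDiffeo (E := F) (E' := E) f)
    (hK : Corresponds f (fun _ => LinearMap.ker π.toLinearMap) K)
    {γ : ℝ → M} (hγ : ContMDiff 𝓘(ℝ, ℝ) 𝓘(ℝ, E) ∞ γ)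
    (h : ∀ t : ℝ, mfderiv 𝓘(ℝ, ℝ) 𝓘(ℝ, E) γ t (1 : ℝ) ∈ K (γ t)) {s : ℝ} (hs : γ s ∈ f.target) :
    ∀ᶠ t in 𝓝 s, π (f.symm (γ t)) = π (f.symm (γ s)) := by
  have ho : IsOpen (γ ⁻¹' f.target) := f.open_target.preimage hγ.continuous
  obtain ⟨ε, hε, hb⟩ := Metric.isOpen_iff.1 ho s hs
  have hd : ∀ t ∈ Metric.ball s ε, HasDerivAt (fun t => π (f.symm (γ t))) 0 t := by
    intro t ht
    have h1 := ((hf.symm.contMDiffAt (hb ht)).mdifferentiableAt (by simp)).hasMFDerivAt.comp t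
      ((hγ.contMDiffAt (x := t)).mdifferentiableAt (by simp)).hasMFDerivAt
    have h2 := (π.hasFDerivAt.comp t h1.hasFDerivAt).hasDerivAt
    exact h2.congr_deriv ((hf.corresponds_symm hK _ (hb ht) _).1 (h t))
  refine Filter.mem_of_superset (Metric.ball_mem_nhds s hε) fun t ht => ?_
  exact Metric.isOpen_ball.is_const_of_deriv_eq_zero (convex_ball s ε).isPreconnected
    (fun t ht => (hd t ht).differentiableAt.differentiableWithinAt)
    (fun t ht => (hd t ht).deriv) ht (Metric.mem_ball_self hε)

namespace FoliatedAtlas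

variable {K : Distribution E M} {r : Setoid M} (P : FoliatedAtlas ι F B K r)

lemma mem_source (i : ι) (a : F) : a ∈ (P.param i).source := by rw [P.source_eq]; trivial

lemma symm_param (i : ι) (a : F) : (P.param i).symm (P.param i a) = a :=
  (P.param i).left_inv (P.mem_source i a)

lemma contMDiff_param (i : ι) : ContMDiff 𝓘(ℝ, F) 𝓘(ℝ, E) ∞ (P.param i) :=
  fun a => (P.isLocalDiffeo i).contMDiffAt (P.mem_source i a)

include P in
lemma rel_of_tangentCurveJoins [CompleteSpace F] {x y : M} (h : TangentCurveJoins K x y) :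
    r x y := by
  obtain ⟨γ, hγ, h, rfl, rfl⟩ := h
  -- The curve may leave every single parametrization; its class is locally constant on the
  -- connected line, hence constant.
  have hc : IsLocallyConstant fun t => (Quotient.mk r (γ t)) := by
    rw [IsLocallyConstant.iff_eventually_eq]
    intro s
    obtain ⟨i, a, ha⟩ := P.cover (γ s)
    have hs : γ s ∈ (P.param i).target := by
      rw [← ha]; exact (P.param i).map_source (P.mem_source i a)
    have ho : IsOpen (γ ⁻¹' (P.param i).target) :=
      (P.param i).open_target.preimage hγ.continuous
    filter_upwards [ho.mem_nhds hs,
      eq_of_mfderiv_mem_ker (P.isLocalDiffeo i) (P.corresponds i) hγ h hs] with t ht h1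
    apply Quotient.sound
    rw [← P.rel_iff i, (P.param i).right_inv ht, (P.param i).right_inv hs] at h1
    exact h1
  exact Quotient.exact (hc.apply_eq_of_isPreconnected isPreconnected_univ (mem_univ 0) (mem_univ 1))

lemma tangentCurveJoins (i : ι) {a b : F} (h : P.π a = P.π b) :
    TangentCurveJoins K (P.param i a) (P.param i b) := by
  -- The segment stays in the fibre of `π`, and the parametrization is defined on all of `F`, so its
  -- image is a curve in the leaf.
  let c : ℝ → F := fun t => a + t • (b - a)
  have hc : ∀ t, HasDerivAt c (b - a) t := fun t => by
    simpa [c] using ((hasDerivAt_id t).smul_const (b - a)).const_add a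
  have hcs : ContDiff ℝ ∞ c := contDiff_const.add (contDiff_id.smul contDiff_const)
  refine ⟨P.param i ∘ c, (P.contMDiff_param i).comp hcs.contMDiff, fun t => ?_, by simp [c],
    by simp [c]⟩
  have h1 := (((P.contMDiff_param i).contMDiffAt (x := c t)).mdifferentiableAt
    (by simp)).hasMFDerivAt.comp t (hc t).hasFDerivAt.hasMFDerivAt
  rw [h1.mfderiv]
  have h2 := (P.corresponds i (c t) (P.mem_source i _) (b - a)).1
    (show P.π (b - a) = 0 by rw [map_sub, h, sub_self])
  have h3 : ((mfderiv 𝓘(ℝ, F) 𝓘(ℝ, E) (P.param i) (c t)).comp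
      (ContinuousLinearMap.toSpanSingleton ℝ (b - a)) : ℝ →L[ℝ] E) 1 =
      mfderiv 𝓘(ℝ, F) 𝓘(ℝ, E) (P.param i) (c t) (b - a) :=
    congrArg (fun v : F => (mfderiv 𝓘(ℝ, F) 𝓘(ℝ, E) (P.param i) (c t) v : E))
      (one_smul ℝ (b - a))
  exact h3 ▸ h2

include P in
-- Tangent curves cannot leave a class; conversely, by `saturated` a class lies in one
-- parametrization, where a segment joins any two of its points.
lemma leafSetoid_iff [CompleteSpace F] {x y : M} : leafSetoid K x y ↔ r x y := by
  constructor
  · intro h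
    induction (h : Relation.EqvGen (TangentCurveJoins K) x y) with
    | rel x y h => exact P.rel_of_tangentCurveJoins h
    | refl x => exact r.refl x
    | symm x y _ ih => exact r.symm ih
    | trans x y z _ _ ih1 ih2 => exact r.trans ih1 ih2
  · intro h
    obtain ⟨i, a, rfl⟩ := P.cover x
    obtain ⟨b, rfl⟩ := P.saturated i a y h
    exact Relation.EqvGen.rel _ _ (P.tangentCurveJoins i ((P.rel_iff i a b).1 h))

/-- The leaf space of `K`, to be equipped with the smooth structure given by `P`. -/
def Leaves (_ : FoliatedAtlas ι F B K r) : Type _ := LeafSpace K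

instance : TopologicalSpace P.Leaves := inferInstanceAs (TopologicalSpace (LeafSpace K))

/-- The projection to the leaf space. -/
def proj (x : M) : P.Leaves := leafProj K x

/-- The parametrization of the leaf space that is induced by a parametrization of `M`. -/
def leafParam (i : ι) (b : B) : P.Leaves := P.proj (P.param i (P.σ b))

lemma continuous_proj : Continuous P.proj := continuous_quotient_mk'

lemma proj_surjective : Function.Surjective P.proj := Quotient.mk_surjective

variable [CompleteSpace F]

lemma proj_eq_iff {x y : M} : P.proj x = P.proj y ↔ r x y :=
  Quotient.eq.trans P.leafSetoid_iff

lemma proj_param (i : ι) (a : F) : P.proj (P.param i a) = P.leafParam i (P.π a) := by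
  rw [leafParam, proj_eq_iff, P.rel_iff, P.π_σ]

lemma leafParam_injective (i : ι) : Function.Injective (P.leafParam i) := by
  intro b b' h
  rwa [leafParam, leafParam, proj_eq_iff, P.rel_iff, P.π_σ, P.π_σ] at h

/-- The saturation of an open set is the union, over the parametrizations, of the images of
saturations under the open linear map `π`. Saturatedness of the parametrizations makes this
exhaustive. -/
lemma isOpenMap_proj [CompleteSpace B] : IsOpenMap P.proj := by
  intro U hU
  have hπ : IsOpenMap P.π := P.π.isOpenMap fun b => ⟨_, P.π_σ b⟩
  have h : P.proj ⁻¹' (P.proj '' U) =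
      ⋃ i, P.param i '' (P.π ⁻¹' (P.π '' (P.param i ⁻¹' U))) := by
    ext x
    simp only [mem_preimage, mem_image, mem_iUnion]
    constructor
    · rintro ⟨y, hy, h⟩
      obtain ⟨i, a, rfl⟩ := P.cover y
      rw [proj_eq_iff] at h
      obtain ⟨b, rfl⟩ := P.saturated i a x h
      exact ⟨i, b, ⟨a, hy, (P.rel_iff i a b).1 h⟩, rfl⟩
    · rintro ⟨i, b, ⟨a, ha, h⟩, rfl⟩
      exact ⟨_, ha, P.proj_eq_iff.2 ((P.rel_iff i a b).2 h)⟩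
  change IsOpen (P.proj ⁻¹' (P.proj '' U))
  rw [h]
  refine isOpen_iUnion fun i => ?_
  refine (P.param i).isOpen_image_of_subset_source ?_ fun a _ => P.mem_source i a
  exact (hπ _ (hU.preimage (P.contMDiff_param i).continuous)).preimage P.π.continuous

lemma isOpenEmbedding_leafParam [CompleteSpace B] (i : ι) :
    Topology.IsOpenEmbedding (P.leafParam i) := by
  refine .of_continuous_injective_isOpenMap ?_ (P.leafParam_injective i) fun U hU => ?_
  · exact P.continuous_proj.comp ((P.contMDiff_param i).continuous.comp P.σ.continuous)
  · have : P.leafParam i '' U = P.proj '' (P.param i '' (P.π ⁻¹' U)) := by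
      rw [image_image]
      simp only [proj_param]
      rw [← image_image (P.leafParam i) P.π, image_preimage_eq _ fun b => ⟨_, P.π_σ b⟩]
    rw [this]
    exact P.isOpenMap_proj _ ((P.param i).isOpen_image_of_subset_source
      (hU.preimage P.π.continuous) fun a _ => P.mem_source i a)

variable [CompleteSpace B]

/-- The parametrization `leafParam` as an open partial homeomorphism. -/
def leafHomeo (i : ι) : OpenPartialHomeomorph B P.Leaves :=
  (P.isOpenEmbedding_leafParam i).toOpenPartialHomeomorph (P.leafParam i)

lemma leafHomeo_apply (i : ι) (b : B) : P.leafHomeo i b = P.leafParam i b := rfl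

lemma leafHomeo_source (i : ι) : (P.leafHomeo i).source = univ := rfl

lemma leafHomeo_target (i : ι) : (P.leafHomeo i).target = range (P.leafParam i) := by
  simp [leafHomeo]

omit [CompleteSpace B] in
lemma leaf_cover (y : P.Leaves) : ∃ i b, P.leafParam i b = y := by
  obtain ⟨x, rfl⟩ := P.proj_surjective y
  obtain ⟨i, a, rfl⟩ := P.cover x
  exact ⟨i, P.π a, (P.proj_param i a).symm⟩

instance : ChartedSpace B P.Leaves where
  atlas := range fun i => (P.leafHomeo i).symm
  chartAt y := (P.leafHomeo (P.leaf_cover y).choose).symm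
  mem_chart_source y := by
    change y ∈ (P.leafHomeo _).target
    rw [leafHomeo_target]
    exact (P.leaf_cover y).choose_spec
  chart_mem_atlas y := ⟨_, rfl⟩

/-- Changes of leaf coordinates have the form `π ∘ (param j)⁻¹ ∘ param i ∘ σ`, hence are smooth. -/
lemma leafParam_symm_leafParam {i j : ι} {b : B} (h : P.leafParam i b ∈ range (P.leafParam j)) :
    P.param i (P.σ b) ∈ (P.param j).target ∧ (P.leafHomeo j).symm (P.leafParam i b) =
      P.π ((P.param j).symm (P.param i (P.σ b))) := by
  obtain ⟨b', h⟩ := h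
  have h1 := h
  rw [leafParam, leafParam, proj_eq_iff] at h1
  obtain ⟨a, ha⟩ := P.saturated j _ _ h1
  refine ⟨by rw [← ha]; exact (P.param j).map_source (P.mem_source j a), ?_⟩
  rw [← ha, symm_param, leafParam, ← ha, proj_param]
  exact (P.leafHomeo j).left_inv (mem_univ _)

instance : IsManifold 𝓘(ℝ, B) ∞ P.Leaves := by
  apply isManifold_of_contDiffOn
  rintro _ _ ⟨i, rfl⟩ ⟨j, rfl⟩
  simp only [modelWithCornersSelf_coe, modelWithCornersSelf_coe_symm, Function.comp_id,
    Function.id_comp, Set.preimage_id, Set.range_id, Set.inter_univ,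
    OpenPartialHomeomorph.symm_symm]
  have hs : ((P.leafHomeo i).trans (P.leafHomeo j).symm).source =
      {b | P.leafParam i b ∈ range (P.leafParam j)} := by
    ext b
    simp [leafHomeo_source, leafHomeo_target, leafHomeo_apply]
  have h1 : ContMDiffOn 𝓘(ℝ, B) 𝓘(ℝ, B) ∞
      (fun b => P.π ((P.param j).symm (P.param i (P.σ b))))
      {b | P.leafParam i b ∈ range (P.leafParam j)} :=
    P.π.contMDiff.comp_contMDiffOn ((P.isLocalDiffeo j).contMDiffOn_symm.comp
      ((P.contMDiff_param i).comp P.σ.contMDiff).contMDiffOn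
      fun b hb => (P.leafParam_symm_leafParam hb).1)
  rw [hs]
  exact (contMDiffOn_iff_contDiffOn.1 h1).congr fun b hb => (P.leafParam_symm_leafParam hb).2

lemma isLocalDiffeo_leafHomeo (i : ι) :
    IsLocalDiffeo (E := B) (E' := B) (P.leafHomeo i) := by
  have h : (P.leafHomeo i).symm ∈ IsManifold.maximalAtlas 𝓘(ℝ, B) ∞ P.Leaves :=
    IsManifold.subset_maximalAtlas ⟨i, rfl⟩
  exact ⟨contMDiffOn_symm_of_mem_maximalAtlas h, contMDiffOn_of_mem_maximalAtlas h⟩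

lemma contMDiff_leafParam (i : ι) : ContMDiff 𝓘(ℝ, B) 𝓘(ℝ, B) ∞ (P.leafParam i) :=
  fun b => (P.isLocalDiffeo_leafHomeo i).contMDiffAt (mem_univ b)

lemma contMDiff_proj : ContMDiff 𝓘(ℝ, E) 𝓘(ℝ, B) ∞ P.proj := by
  intro x
  obtain ⟨i, a, rfl⟩ := P.cover x
  have ha := (P.param i).map_source (P.mem_source i a)
  refine (((P.contMDiff_leafParam i).comp P.π.contMDiff).contMDiffAt.comp _
    ((P.isLocalDiffeo i).symm.contMDiffAt ha)).congr_of_eventuallyEq ?_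
  filter_upwards [(P.param i).open_target.mem_nhds ha] with y hy
  rw [Function.comp_apply, Function.comp_apply, ← proj_param, (P.param i).right_inv hy]

/-- In a parametrization the projection to the leaf space is the linear map `π`; this is the chain
rule for that identity. -/
lemma mfderiv_proj (i : ι) (a v : F) :
    (mfderiv 𝓘(ℝ, E) 𝓘(ℝ, B) P.proj (P.param i a)
      (mfderiv 𝓘(ℝ, F) 𝓘(ℝ, E) (P.param i) a v) : B) =
      mfderiv 𝓘(ℝ, B) 𝓘(ℝ, B) (P.leafParam i) (P.π a) (P.π v) := by
  have h : P.proj ∘ P.param i = P.leafParam i ∘ P.π := funext fun a => P.proj_param i a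
  have h1 := (P.contMDiff_proj.contMDiffAt.mdifferentiableAt (by simp)).hasMFDerivAt.comp a
    ((P.contMDiff_param i).contMDiffAt.mdifferentiableAt (by simp)).hasMFDerivAt
  have h2 := ((P.contMDiff_leafParam i).contMDiffAt.mdifferentiableAt (by simp)).hasMFDerivAt.comp a
    P.π.hasFDerivAt.hasMFDerivAt
  rw [h] at h1
  exact DFunLike.congr_fun (hasMFDerivAt_unique h1 h2) v

lemma surjective_mfderiv_proj (x : M) :
    Function.Surjective (mfderiv 𝓘(ℝ, E) 𝓘(ℝ, B) P.proj x) := by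
  intro w
  obtain ⟨i, a, rfl⟩ := P.cover x
  have h := (P.isLocalDiffeo_leafHomeo i).mfderiv_apply_symm (x := P.π a) (mem_univ _)
  refine ⟨mfderiv 𝓘(ℝ, F) 𝓘(ℝ, E) (P.param i) a (P.σ (mfderiv 𝓘(ℝ, B) 𝓘(ℝ, B)
    (P.leafHomeo i).symm (P.leafHomeo i (P.π a)) w)), (P.mfderiv_proj i a _).trans ?_⟩
  exact (congrArg (fun u : B => (mfderiv 𝓘(ℝ, B) 𝓘(ℝ, B) (P.leafParam i) (P.π a) u : B))
    (P.π_σ _)).trans (h w)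

/-- The image in the tangent space of the leaf space of the plane of `D` at `x`. -/
def image (D : Distribution E M) (x : M) : Submodule ℝ B :=
  (D x).map (mfderiv 𝓘(ℝ, E) 𝓘(ℝ, B) P.proj x).toLinearMap

variable {D : Distribution E M} {D' : ι → Distribution B B}
  (hD : ∀ i, Corresponds (P.param i) (fun a => (D' i (P.π a)).comap P.π.toLinearMap) D)

include hD

lemma mem_image_iff (i : ι) (a : F) (w : B) :
    w ∈ P.image D (P.param i a) ↔
      ∃ u : B, u ∈ D' i (P.π a) ∧ mfderiv 𝓘(ℝ, B) 𝓘(ℝ, B) (P.leafParam i) (P.π a) u = w := by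
  constructor
  · rintro ⟨v, hv, rfl⟩
    have h1 := (P.isLocalDiffeo i).mfderiv_apply_symm (P.mem_source i a) v
    set e : F := mfderiv 𝓘(ℝ, E) 𝓘(ℝ, F) (P.param i).symm (P.param i a) v
    rw [← h1] at hv ⊢
    exact ⟨P.π e, (hD i a (P.mem_source i a) e).2 hv, (P.mfderiv_proj i a e).symm⟩
  · rintro ⟨u, hu, rfl⟩
    refine ⟨mfderiv 𝓘(ℝ, F) 𝓘(ℝ, E) (P.param i) a (P.σ u),
      (hD i a (P.mem_source i a) (P.σ u)).1 ?_, ?_⟩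
    · change P.π (P.σ u) ∈ D' i (P.π a)
      rwa [P.π_σ]
    · refine (P.mfderiv_proj i a (P.σ u)).trans ?_
      rw [P.π_σ]

/-- In a parametrization the image is determined by `D' i` at `π a`, and `π a` is constant along the
leaf. This makes the induced distribution well defined. -/
lemma image_eq {x y : M} (h : r x y) : P.image D x = P.image D y := by
  obtain ⟨i, a, rfl⟩ := P.cover x
  obtain ⟨b, rfl⟩ := P.saturated i a y h
  ext w
  rw [P.mem_image_iff hD, P.mem_image_iff hD, (P.rel_iff i a b).1 h]

/-- The distribution induced on the leaf space. -/
def leafDist : Distribution B P.Leaves :=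
  Quotient.lift (P.image D) fun _ _ h => P.image_eq hD (P.leafSetoid_iff.1 h)

lemma eq_comap_leafDist (x : M) :
    D x = (P.leafDist hD (P.proj x)).comap (mfderiv 𝓘(ℝ, E) 𝓘(ℝ, B) P.proj x).toLinearMap := by
  obtain ⟨i, a, rfl⟩ := P.cover x
  refine le_antisymm (fun v hv => ⟨v, hv, rfl⟩) fun v hv => ?_
  obtain ⟨u, hu, h⟩ := (P.mem_image_iff hD i a _).1 hv
  have h1 := (P.isLocalDiffeo i).mfderiv_apply_symm (P.mem_source i a) v
  set e : F := mfderiv 𝓘(ℝ, E) 𝓘(ℝ, F) (P.param i).symm (P.param i a) v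
  rw [← h1] at h ⊢
  refine (hD i a (P.mem_source i a) e).1 ?_
  have h2 := h.trans (P.mfderiv_proj i a e)
  have h3 := (P.isLocalDiffeo_leafHomeo i).mfderiv_symm_apply (x := P.π a) (mem_univ _)
  -- The differential of a leaf parametrization is injective.
  have h4 : u = P.π e := by
    rw [← h3 u, ← h3 (P.π e)]
    exact congrArg _ h2
  rw [h4] at hu
  exact hu

lemma corresponds_leafDist (i : ι) : Corresponds (P.leafHomeo i) (D' i) (P.leafDist hD) := by
  intro b _ v
  have h1 := (P.isLocalDiffeo_leafHomeo i).mfderiv_symm_apply (x := b) (mem_univ _)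
  refine Iff.trans ?_ (P.mem_image_iff hD i (P.σ b) _).symm
  rw [P.π_σ]
  constructor
  · exact fun hv => ⟨v, hv, rfl⟩
  · rintro ⟨u, hu, h⟩
    have h2 : u = v := by
      rw [← h1 u, ← h1 v]
      exact congrArg _ h
    rwa [← h2]

lemma isSmoothDistribution_leafDist (hs : ∀ i, IsSmoothDistribution (D' i)) :
    IsSmoothDistribution (P.leafDist hD) := by
  intro y
  obtain ⟨i, b, rfl⟩ := P.leaf_cover y
  have hf := P.isLocalDiffeo_leafHomeo i
  refine hf.symm.exists_frame (hf.corresponds_symm (P.corresponds_leafDist hD i)) (hs i)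
    ((P.leafHomeo i).map_source (mem_univ b))

end FoliatedAtlas

theorem FoliatedAtlas.descendsToLeafSpace [CompleteSpace F] {K D : Distribution E M}
    {r : Setoid M} {d : ℕ} (P : FoliatedAtlas ι F (EuclideanSpace ℝ (Fin d)) K r)
    {D' : ι → Distribution (EuclideanSpace ℝ (Fin d)) (EuclideanSpace ℝ (Fin d))}
    (hD : ∀ i, Corresponds (P.param i) (fun a => (D' i (P.π a)).comap P.π.toLinearMap) D)
    (hs : ∀ i, IsSmoothDistribution (D' i)) : DescendsToLeafSpace D K :=
  ⟨d, inferInstanceAs (ChartedSpace (EuclideanSpace ℝ (Fin d)) P.Leaves),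
    inferInstanceAs (IsManifold 𝓘(ℝ, EuclideanSpace ℝ (Fin d)) ∞ P.Leaves),
    P.contMDiff_proj, P.surjective_mfderiv_proj, P.leafDist hD,
    P.isSmoothDistribution_leafDist hD hs, P.eq_comap_leafDist hD⟩

end LeafSpaces

/-! ### Pullbacks and derivations of symmetric forms. -/

section SymmetricForms

variable {U V W : Type*} [NormedAddCommGroup U] [NormedSpace ℝ U] [NormedAddCommGroup V]
  [NormedSpace ℝ V] [NormedAddCommGroup W] [NormedSpace ℝ W] {r p : ℕ}

instance [FiniteDimensional ℝ U] [FiniteDimensional ℝ W] :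
    FiniteDimensional ℝ (U [×r]→L[ℝ] W) :=
  Module.Finite.of_injective
    (ContinuousMultilinearMap.toMultilinearMapLinear :
      (U [×r]→L[ℝ] W) →ₗ[ℝ] MultilinearMap ℝ (fun _ : Fin r => U) W)
    ContinuousMultilinearMap.toMultilinearMap_injective

/-- The pullback of symmetric forms. -/
def pull (g : U →L[ℝ] V) : SymForm V W r →ₗ[ℝ] SymForm U W r where
  toFun f := ⟨f.1.compContinuousLinearMap fun _ => g, fun σ w => f.2 σ (g ∘ w)⟩
  map_add' _ _ := rfl
  map_smul' _ _ := rfl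

lemma pull_apply (g : U →L[ℝ] V) (f : SymForm V W r) (w : Fin r → U) :
    (pull g f).1 w = f.1 (g ∘ w) := rfl

lemma pull_pull {U' : Type*} [NormedAddCommGroup U'] [NormedSpace ℝ U'] (g : U →L[ℝ] V)
    (g' : U' →L[ℝ] U) (f : SymForm V W r) : pull g' (pull g f) = pull (g ∘L g') f := rfl

lemma pull_id (f : SymForm V W r) : pull (ContinuousLinearMap.id ℝ V) f = f := rfl

/-- The derivation of the algebra of symmetric forms given by an endomorphism `g`. -/
def derivSym (g : U →L[ℝ] U) (f : SymForm U W r) : SymForm U W r :=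
  ⟨∑ i, f.1.compContinuousLinearMap (Function.update (fun _ => ContinuousLinearMap.id ℝ U) i g), by
    intro σ w
    simp only [sum_apply,
      ContinuousMultilinearMap.compContinuousLinearMap_apply]
    refine Fintype.sum_equiv σ _ _ fun i => ?_
    refine Eq.trans ?_ (f.2 σ _)
    congr 1
    funext j
    by_cases h : j = i
    · subst h; simp
    · simp [h]⟩

lemma derivSym_apply (g : U →L[ℝ] U) (f : SymForm U W r) (w : Fin r → U) :
    (derivSym g f).1 w = ∑ i, f.1 (Function.update w i (g (w i))) := by
  simp only [derivSym, sum_apply,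
      ContinuousMultilinearMap.compContinuousLinearMap_apply]
  refine Finset.sum_congr rfl fun i _ => ?_
  congr 1
  funext j
  by_cases h : j = i
  · subst h; simp
  · simp [h]

lemma derivSym_comm {g g' : U →L[ℝ] U} (h : ∀ u, g (g' u) = 0) (h' : ∀ u, g' (g u) = 0)
    (f : SymForm U W r) : derivSym g (derivSym g' f) = derivSym g' (derivSym g f) := by
  ext w
  simp only [derivSym_apply]
  rw [Finset.sum_comm]
  refine Finset.sum_congr rfl fun i _ => Finset.sum_congr rfl fun j _ => ?_
  -- On the diagonal both compositions of `g` and `g'` vanish; off the diagonal the two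
  -- substitutions act in different slots.
  by_cases hij : i = j
  · subst hij
    simp [h, h']
  · rw [Function.update_of_ne hij, Function.update_of_ne (Ne.symm hij),
      Function.update_comm hij]

lemma muFilt_le_succ (D : Submodule ℝ U) :
    (muFilt r p D : Submodule ℝ (SymForm U W r)) ≤ muFilt r (p + 1) D := by
  intro f hf S hS w hw
  obtain ⟨S', hS', hc⟩ := Finset.exists_subset_card_eq (show p ≤ S.card by omega)
  exact hf S' hc w fun i hi => hw i (hS' hi)

/-- The slots are released one at a time, from the generators to their span, by linearity in that
slot. -/
lemma eq_zero_of_mem_span (f : U [×r]→L[ℝ] W) (s : Fin r → Set U)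
    (h : ∀ w, (∀ i, w i ∈ s i) → f w = 0) {w : Fin r → U}
    (hw : ∀ i, w i ∈ Submodule.span ℝ (s i)) : f w = 0 := by
  have key : ∀ (F : Finset (Fin r)) (w : Fin r → U), (∀ i ∈ F, w i ∈ Submodule.span ℝ (s i)) →
      (∀ i ∉ F, w i ∈ s i) → f w = 0 := by
    intro F
    induction F using Finset.induction_on with
    | empty => exact fun w _ hw => h w fun i => hw i (by simp)
    | insert a F ha ih =>
      intro w h1 h2
      have h3 : ∀ x ∈ Submodule.span ℝ (s a), f (Function.update w a x) = 0 := by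
        intro x hx
        induction hx using Submodule.span_induction with
        | mem x hx =>
          refine ih _ (fun i hi => ?_) fun i hi => ?_
          · rw [Function.update_of_ne (by rintro rfl; exact ha hi)]
            exact h1 i (Finset.mem_insert_of_mem hi)
          · by_cases hia : i = a
            · subst hia; simpa using hx
            · rw [Function.update_of_ne hia]
              exact h2 i (by simp [hia, hi])
        | zero => exact f.map_update_zero w a
        | add x y _ _ hx hy => rw [f.map_update_add, hx, hy, add_zero]
        | smul c x _ hx => rw [f.map_update_smul, hx, smul_zero]
      rw [← Function.update_eq_self a w]
      exact h3 _ (h1 a (Finset.mem_insert_self a F))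
  exact key Finset.univ w (fun i _ => hw i) (by simp)

end SymmetricForms

/-! ### How the derivations `N_B` act on the filtration by degree along the first factor. -/

section Product

variable {X Y W : Type*} [NormedAddCommGroup X] [NormedSpace ℝ X] [NormedAddCommGroup Y]
  [NormedSpace ℝ Y] [NormedAddCommGroup W] [NormedSpace ℝ W]
  {r p : ℕ}

variable (X Y) in
/-- The first factor of `X × Y`. -/
def firstFactor : Submodule ℝ (X × Y) := LinearMap.ker (LinearMap.snd ℝ X Y)

lemma mem_firstFactor {u : X × Y} : u ∈ firstFactor X Y ↔ u.2 = 0 := Iff.rfl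

/-- The nilpotent endomorphism `(x, y) ↦ (0, B x)` of `X × Y`. -/
def nilp (B : X →L[ℝ] Y) : X × Y →L[ℝ] X × Y :=
  ContinuousLinearMap.inr ℝ X Y ∘L B ∘L ContinuousLinearMap.fst ℝ X Y

lemma nilp_apply (B : X →L[ℝ] Y) (u : X × Y) : nilp B u = (0, B u.1) := rfl

/-- Each term of the derivation alters a single slot, so of `p + 1` slots in `D` at least `p`
survive. -/
lemma derivSym_mem_muFilt (g : X × Y →L[ℝ] X × Y) {m : SymForm (X × Y) W r}
    {D : Submodule ℝ (X × Y)} (hm : m ∈ muFilt r p D) : derivSym g m ∈ muFilt r (p + 1) D := by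
  intro S hS w hw
  rw [derivSym_apply]
  refine Finset.sum_eq_zero fun i _ => ?_
  obtain ⟨S', hS', hc⟩ := Finset.exists_subset_card_eq
    (show p ≤ (S.erase i).card by have := Finset.pred_card_le_card_erase (s := S) (a := i); omega)
  refine hm S' hc _ fun j hj => ?_
  have := hS' hj
  rw [Finset.mem_erase] at this
  rw [Function.update_of_ne this.1]
  exact hw j this.2

/-- To evaluate `m` on `p` vectors of `X` and some further vector, only the `Y`-component `y` of the
latter matters, as `m ∈ μ^(p+1)`. Write `y = B x` with `x` in `X`: then the value is recovered, up
to a positive integer factor, from `N_B m` on arguments with `p + 1` slots in `X`. -/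
lemma mem_muFilt_of_derivSym_mem [FiniteDimensional ℝ X] [Nontrivial X] (hp : p < r) {m : SymForm (X × Y) W r}
    (hm : m ∈ muFilt r (p + 1) (firstFactor X Y))
    (h : ∀ B : X →L[ℝ] Y, derivSym (nilp B) m ∈ muFilt r (p + 1) (firstFactor X Y)) :
    m ∈ muFilt r p (firstFactor X Y) := by
  classical
  intro S hS w hw
  let b := Module.finBasis ℝ X
  have hpos : 0 < finrank ℝ X := finrank_pos
  let j₁ : Fin (finrank ℝ X) := ⟨0, hpos⟩
  -- The slots in `S` may be assumed to carry basis vectors of `X`, on which `B` below is either `y`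
  -- or zero.
  refine eq_zero_of_mem_span m.1
    (fun i => if i ∈ S then range (fun j => (b j, (0 : Y))) else univ) (fun w hw => ?_) fun i => ?_
  swap
  · split_ifs with hi
    · have h1 : range (fun j => (b j, (0 : Y))) = LinearMap.inl ℝ X Y '' range b := by
        rw [← range_comp]; rfl
      rw [h1, Submodule.span_image, b.span_eq]
      exact ⟨(w i).1, trivial, Prod.ext rfl (mem_firstFactor.1 (hw i hi)).symm⟩
    · rw [Submodule.span_univ]; trivial
  -- A free slot exists because `p < r`.
  obtain ⟨i₀, hi₀⟩ : ∃ i₀, i₀ ∉ S := by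
    by_contra! hc
    have : S = Finset.univ := Finset.eq_univ_iff_forall.2 hc
    rw [this, Finset.card_univ, Fintype.card_fin] at hS
    omega
  have hS' : (insert i₀ S).card = p + 1 := by rw [Finset.card_insert_of_notMem hi₀, hS]
  have hwS : ∀ i ∈ S, ∃ j, w i = (b j, 0) := fun i hi => by
    have := hw i
    rw [if_pos hi] at this
    obtain ⟨j, hj⟩ := this
    exact ⟨j, hj.symm⟩
  set y := (w i₀).2
  let B : X →L[ℝ] Y := LinearMap.toContinuousLinearMap ((b.coord j₁).smulRight y)
  have hB : ∀ j, B (b j) = if j = j₁ then y else 0 := fun j => by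
    simp [B, Finsupp.single_apply, ite_smul]
  set w' := Function.update w i₀ (b j₁, 0) with hw'
  have hw'S : ∀ i ∈ insert i₀ S, ∃ j, w' i = (b j, 0) := by
    intro i hi
    by_cases hii : i = i₀
    · subst hii; exact ⟨j₁, by simp [hw']⟩
    · rw [hw', Function.update_of_ne hii]
      exact hwS i (Finset.mem_of_mem_insert_of_ne hi hii)
  have hw'D : ∀ i ∈ insert i₀ S, w' i ∈ firstFactor X Y := fun i hi => by
    obtain ⟨j, hj⟩ := hw'S i hi
    rw [hj]; rfl
  have hsum := h B (insert i₀ S) hS' w' hw'D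
  rw [derivSym_apply] at hsum
  set v := m.1 (Function.update w i₀ (0, y)) with hv
  -- A slot of `insert i₀ S` holding `b j₁` contributes `v`, by symmetry of `m`; one holding another
  -- basis vector contributes zero. Altering any other slot leaves `p + 1` arguments in `X`, so that
  -- term vanishes too.
  have hterm : ∀ i, m.1 (Function.update w' i (nilp B (w' i))) =
      if i ∈ insert i₀ S ∧ w' i = (b j₁, 0) then v else 0 := by
    intro i
    by_cases hi : i ∈ insert i₀ S
    · obtain ⟨j, hj⟩ := hw'S i hi
      by_cases hjj : j = j₁
      · subst hjj
        rw [if_pos ⟨hi, hj⟩, hj, nilp_apply, hB, if_pos rfl, hv,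
          ← m.2 (Equiv.swap i i₀) (Function.update w i₀ (0, y))]
        congr 1
        funext t
        rw [Function.comp_apply]
        by_cases hti : t = i
        · subst hti; simp
        · rw [Function.update_of_ne hti]
          by_cases hti₀ : t = i₀
          · subst hti₀
            rw [Equiv.swap_apply_right, Function.update_of_ne (Ne.symm hti)]
            rw [hw', Function.update_of_ne (Ne.symm hti)] at hj
            rw [hj]; simp [hw']
          · rw [Equiv.swap_apply_of_ne_of_ne hti hti₀, Function.update_of_ne hti₀, hw',
              Function.update_of_ne hti₀]
      · rw [if_neg, hj, nilp_apply, hB, if_neg hjj]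
        · exact m.1.map_update_zero _ _
        · rintro ⟨-, h2⟩
          rw [hj] at h2
          exact hjj (b.injective (congrArg Prod.fst h2))
    · rw [if_neg fun h => hi h.1]
      refine hm _ hS' _ fun t ht => ?_
      rw [Function.update_of_ne (by rintro rfl; exact hi ht)]
      exact hw'D t ht
  rw [Finset.sum_congr rfl fun i _ => hterm i, ← Finset.sum_filter, Finset.sum_const] at hsum
  have hv0 : v = 0 := by
    rw [← Nat.cast_smul_eq_nsmul ℝ] at hsum
    refine (smul_eq_zero.1 hsum).resolve_left ?_
    -- The multiplicity of `v` is positive because slot `i₀` itself is counted.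
    exact Nat.cast_ne_zero.2 (Finset.card_pos.2 ⟨i₀, by simp [hw']⟩).ne'
  have hsplit : w i₀ = ((w i₀).1, 0) + (0, y) := by simp [y]
  rw [← Function.update_eq_self i₀ w, hsplit, m.1.map_update_add, ← hv, hv0, add_zero]
  refine hm _ hS' _ fun i hi => ?_
  by_cases hii : i = i₀
  · subst hii; simp [mem_firstFactor]
  · rw [Function.update_of_ne hii]
    obtain ⟨j, hj⟩ := hwS i (Finset.mem_of_mem_insert_of_ne hi hii)
    rw [hj]; rfl

/-- The symmetric form `α^p β^(r-p) w₀`, up to normalization. -/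
def monomialForm (p r : ℕ) (α : X →L[ℝ] ℝ) (β : Y →L[ℝ] ℝ) (w₀ : W) : SymForm (X × Y) W r :=
  ⟨∑ S ∈ Finset.powersetCard p (Finset.univ : Finset (Fin r)),
    ((ContinuousMultilinearMap.mkPiAlgebra ℝ (Fin r) ℝ).compContinuousLinearMap
      (fun i => if i ∈ S then α ∘L ContinuousLinearMap.fst ℝ X Y
        else β ∘L ContinuousLinearMap.snd ℝ X Y)).smulRight w₀, by
    intro σ w
    simp only [sum_apply, ContinuousMultilinearMap.smulRight_apply,
      ContinuousMultilinearMap.compContinuousLinearMap_apply,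
      ContinuousMultilinearMap.mkPiAlgebra_apply]
    -- A permutation of the arguments only permutes the subsets of size `p` in the sum.
    refine Finset.sum_bij (fun S _ => S.map σ.toEmbedding) (fun S hS => ?_) (fun S _ S' _ h => ?_)
      (fun S hS => ⟨S.map σ.symm.toEmbedding, ?_, ?_⟩) fun S hS => ?_
    · simpa using hS
    · exact Finset.map_injective _ h
    · simpa using hS
    · ext i; simp
    · congr 1
      refine Fintype.prod_equiv σ _ _ fun i => ?_
      simp⟩

lemma monomialForm_apply (p r : ℕ) (α : X →L[ℝ] ℝ) (β : Y →L[ℝ] ℝ) (w₀ : W) (w : Fin r → X × Y) :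
    (monomialForm p r α β w₀).1 w = ∑ S ∈ Finset.powersetCard p (Finset.univ : Finset (Fin r)),
      (∏ i, if i ∈ S then α (w i).1 else β (w i).2) • w₀ := by
  simp only [monomialForm, sum_apply, ContinuousMultilinearMap.smulRight_apply,
      ContinuousMultilinearMap.compContinuousLinearMap_apply,
      ContinuousMultilinearMap.mkPiAlgebra_apply]
  refine Finset.sum_congr rfl fun S _ => ?_
  congr 1
  refine Finset.prod_congr rfl fun i _ => ?_
  split_ifs <;> rfl

lemma monomialForm_mem (p r : ℕ) (α : X →L[ℝ] ℝ) (β : Y →L[ℝ] ℝ) (w₀ : W) :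
    monomialForm p r α β w₀ ∈ muFilt r (p + 1) (firstFactor X Y) := by
  intro S hS w hw
  rw [monomialForm_apply]
  refine Finset.sum_eq_zero fun S' hS' => ?_
  rw [Finset.mem_powersetCard] at hS'
  obtain ⟨i, hi, hi'⟩ := Finset.exists_mem_notMem_of_card_lt_card
    (show S'.card < S.card by omega)
  rw [Finset.prod_eq_zero (Finset.mem_univ i), zero_smul]
  rw [if_neg hi', mem_firstFactor.1 (hw i hi), map_zero]

/-- On these arguments every subset other than `S` contributes a zero factor. -/
lemma monomialForm_apply_ite {α : X →L[ℝ] ℝ} {β : Y →L[ℝ] ℝ} {x : X} {y : Y} (hα : α x = 1)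
    (hβ : β y = 1) (w₀ : W) {S : Finset (Fin r)} (hS : S.card = p) :
    (monomialForm p r α β w₀).1 (fun i => if i ∈ S then (x, 0) else (0, y)) = w₀ := by
  rw [monomialForm_apply, Finset.sum_eq_single_of_mem S (by simp [hS])]
  · rw [Finset.prod_eq_one, one_smul]
    intro i _
    split_ifs <;> simpa
  · intro S' hS' hne
    rw [Finset.mem_powersetCard] at hS'
    have : ∃ i ∈ S', i ∉ S := by
      by_contra! h
      exact hne (Finset.eq_of_subset_of_card_le h (by omega))
    obtain ⟨i, hi, hi'⟩ := this
    rw [Finset.prod_eq_zero (Finset.mem_univ i), zero_smul]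
    simp [hi, hi']

/-- If `B x ≠ 0`, choose `α x = 1` and `β (B x) = 1`. The form `α^p β^(r-p) w₀` lies in `μ^(p+1)`,
but `N_B` turns a factor `β` into `α` up to a multiple, and its value on `p + 1` copies of `x` and
`r - p - 1` copies of `B x` is `(p + 1) w₀`. -/
lemma eq_zero_of_derivSym_mem [Nontrivial W] (hp : p < r) {B : X →L[ℝ] Y}
    (h : ∀ m : SymForm (X × Y) W r, m ∈ muFilt r (p + 1) (firstFactor X Y) →
      derivSym (nilp B) m ∈ muFilt r (p + 1) (firstFactor X Y)) : B = 0 := by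
  by_contra hB
  obtain ⟨x, hx⟩ : ∃ x, B x ≠ 0 := by
    by_contra! hc
    exact hB (ContinuousLinearMap.ext hc)
  obtain ⟨α, hα⟩ := SeparatingDual.exists_eq_one (R := ℝ)
    (show x ≠ 0 by rintro rfl; exact hx (map_zero B))
  obtain ⟨β, hβ⟩ := SeparatingDual.exists_eq_one (R := ℝ) hx
  obtain ⟨w₀, hw₀⟩ := exists_ne (0 : W)
  obtain ⟨S, -, hS⟩ := Finset.exists_subset_card_eq
    (show p + 1 ≤ (Finset.univ : Finset (Fin r)).card by simpa using hp)
  have h1 := h _ (monomialForm_mem p r α β w₀) S hS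
    (fun i => if i ∈ S then (x, 0) else (0, B x)) fun i hi => by simp [hi, mem_firstFactor]
  rw [derivSym_apply] at h1
  have hterm : ∀ i, (monomialForm p r α β w₀).1
      (Function.update (fun i => if i ∈ S then (x, 0) else (0, B x)) i
        (nilp B (if i ∈ S then (x, 0) else (0, B x)))) = if i ∈ S then w₀ else 0 := by
    intro i
    split_ifs with hi
    · have h2 : (Function.update (fun i => if i ∈ S then (x, 0) else (0, B x)) i
          (nilp B (x, 0))) = fun j => if j ∈ S.erase i then (x, 0) else (0, B x) := by
        funext j
        by_cases hj : j = i
        · subst hj; simp [nilp_apply]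
        · simp [hj]
      rw [h2]
      exact monomialForm_apply_ite hα hβ w₀ (by rw [Finset.card_erase_of_mem hi, hS]; rfl)
    · rw [nilp_apply, map_zero]
      exact (monomialForm p r α β w₀).1.map_update_zero _ _
  rw [Finset.sum_congr rfl fun i _ => hterm i, Finset.sum_ite_mem, Finset.univ_inter,
    Finset.sum_const, hS, ← Nat.cast_smul_eq_nsmul ℝ] at h1
  exact hw₀ ((smul_eq_zero.1 h1).resolve_left (Nat.cast_ne_zero.2 (Nat.succ_ne_zero p)))

end Product

/-! ### The linear quotient by `0 × μ₀` and the image of the model distribution. -/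

section ShearQuotient

lemma isSmoothDistribution_of_linearMap {B Z : Type*} [NormedAddCommGroup B] [NormedSpace ℝ B]
    [AddCommGroup Z] [Module ℝ Z] [Module.Finite ℝ Z] {D : Distribution B B} (G : B → Z →ₗ[ℝ] B)
    (hinj : ∀ b, Function.Injective (G b)) (hG : ∀ z, ContDiff ℝ ∞ fun b => G b z)
    (hD : ∀ b, LinearMap.range (G b) = D b) : IsSmoothDistribution D := by
  intro x
  let β := Module.finBasis ℝ Z
  refine ⟨univ, isOpen_univ, mem_univ _, _, fun i b => G b (β i), fun i => ?_, fun b _ => ⟨?_, ?_⟩⟩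
  · exact contMDiffOn_vectorSpace_iff_contDiffOn.2 (hG _).contDiffOn
  · exact β.linearIndependent.map' (G b) (LinearMap.ker_eq_bot.2 (hinj b))
  · rw [← hD, LinearMap.range_eq_map, ← β.span_eq, Submodule.map_span, ← range_comp]
    rfl

variable {A T : Type*} [NormedAddCommGroup A] [NormedSpace ℝ A] [NormedAddCommGroup T]
  [NormedSpace ℝ T]

lemma exists_quotient_fiberDist [FiniteDimensional ℝ T] (A : Type*) [NormedAddCommGroup A] [NormedSpace ℝ A]
    [FiniteDimensional ℝ A] (μ₀ : Submodule ℝ T) :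
    ∃ (d : ℕ) (π : A × T →L[ℝ] EuclideanSpace ℝ (Fin d)) (σ : EuclideanSpace ℝ (Fin d) →L[ℝ] A × T),
      (∀ b, π (σ b) = b) ∧ ∀ a, π a = 0 ↔ a.1 = 0 ∧ a.2 ∈ μ₀ := by
  obtain ⟨d, q, hq, hker⟩ := exists_clm_ker_eq μ₀
  let κ : (A × (Fin d → ℝ)) ≃L[ℝ] EuclideanSpace ℝ (Fin (finrank ℝ (A × (Fin d → ℝ)))) :=
    ContinuousLinearEquiv.ofFinrankEq (by simp)
  let π : A × T →L[ℝ] EuclideanSpace ℝ (Fin (finrank ℝ (A × (Fin d → ℝ)))) :=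
    κ.toContinuousLinearMap ∘L (ContinuousLinearMap.id ℝ A).prodMap q
  have hπ : Function.Surjective π := by
    refine κ.surjective.comp ?_
    rintro ⟨a, c⟩
    obtain ⟨t, rfl⟩ := hq c
    exact ⟨(a, t), rfl⟩
  obtain ⟨σ, hσ⟩ := π.toLinearMap.exists_rightInverse_of_surjective (LinearMap.range_eq_top.2 hπ)
  refine ⟨_, π, LinearMap.toContinuousLinearMap σ, fun b => DFunLike.congr_fun hσ b, fun a => ?_⟩
  rw [← hker]
  simp [π, Prod.ext_iff]

variable {N : A →L[ℝ] T →L[ℝ] T} {μ μ₀ : Submodule ℝ T} {d : ℕ}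
  {π : A × T →L[ℝ] EuclideanSpace ℝ (Fin d)} {σ : EuclideanSpace ℝ (Fin d) →L[ℝ] A × T}

/-- The image of the distribution `shearDist N μ` under a linear map `π` with section `σ`. -/
def shearImage (N : A →L[ℝ] T →L[ℝ] T) (μ : Submodule ℝ T)
    (π : A × T →L[ℝ] EuclideanSpace ℝ (Fin d)) (σ : EuclideanSpace ℝ (Fin d) →L[ℝ] A × T) :
    Distribution (EuclideanSpace ℝ (Fin d)) (EuclideanSpace ℝ (Fin d)) :=
  fun b => Submodule.map π.toLinearMap (shearDist N μ (σ b) : Submodule ℝ (A × T))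

/-- Points with the same image differ by some `(0, m)` with `m ∈ μ₀`, and `N B m ∈ μ` means that
they carry the same plane. This plane contains `ker π`, so it is the full preimage of its image. -/
lemma mem_shearImage (hμ : μ₀ ≤ μ) (h0 : ∀ B, ∀ m ∈ μ₀, N B m ∈ μ) (hσ : ∀ b, π (σ b) = b)
    (hπ : ∀ a, π a = 0 ↔ a.1 = 0 ∧ a.2 ∈ μ₀) (a v : A × T) :
    π v ∈ shearImage N μ π σ (π a) ↔ v ∈ shearDist N μ a := by
  have h1 : (σ (π a) - a).2 ∈ μ₀ := ((hπ _).1 (by rw [map_sub, hσ, sub_self])).2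
  have key : ∀ u : A × T, u ∈ shearDist N μ (σ (π a)) ↔ u ∈ shearDist N μ a := by
    intro u
    have h2 := h0 u.1 _ h1
    rw [Prod.snd_sub, map_sub] at h2
    rw [mem_shearDist, mem_shearDist, ← Submodule.add_mem_iff_left μ h2]
    simp
  constructor
  · rintro ⟨u, hu, huv⟩
    have h2 := (key u).1 hu
    have h3 := (hπ (v - u)).1 (by rw [map_sub, sub_eq_zero]; exact huv.symm)
    rw [mem_shearDist] at h2 ⊢
    rw [Prod.fst_sub, sub_eq_zero] at h3
    rw [h3.1]
    have := add_mem h2 (hμ h3.2)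
    rw [Prod.snd_sub] at this
    convert this using 1
    abel
  · exact fun hv => ⟨v, (key v).2 hv, rfl⟩

lemma isSmoothDistribution_shearImage [FiniteDimensional ℝ A] [FiniteDimensional ℝ T]
    (hμ : μ₀ ≤ μ)
    (hπ : ∀ a, π a = 0 ↔ a.1 = 0 ∧ a.2 ∈ μ₀) : IsSmoothDistribution (shearImage N μ π σ) := by
  obtain ⟨C', hC'⟩ := Submodule.exists_isCompl μ₀
  -- `C` is a complement of `μ₀` in `μ`; the vectors `(B, N_B t + c)` with `c ∈ C` project
  -- injectively and span the image plane.
  let C : Submodule ℝ T := μ ⊓ C'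
  let G : EuclideanSpace ℝ (Fin d) → (A × C) →ₗ[ℝ] EuclideanSpace ℝ (Fin d) := fun b =>
    π.toLinearMap ∘ₗ (LinearMap.fst ℝ A C).prod ((N.flip (σ b).2).toLinearMap ∘ₗ
      LinearMap.fst ℝ A C + C.subtype ∘ₗ LinearMap.snd ℝ A C)
  have hGa : ∀ b z, G b z = π (z.1, N z.1 (σ b).2 + z.2) := fun b z => rfl
  refine isSmoothDistribution_of_linearMap G (fun b => ?_) (fun z => ?_) fun b => ?_
  · rw [injective_iff_map_eq_zero]
    rintro ⟨a, c⟩ h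
    rw [hGa, hπ] at h
    obtain ⟨rfl, h2⟩ := h
    have h3 : (c : T) ∈ μ₀ := by simpa using h2
    have h4 : (c : T) = 0 := Submodule.disjoint_def.1 hC'.disjoint _ h3 c.2.2
    exact Prod.ext rfl (Subtype.ext h4)
  · simp only [hGa]
    exact π.contDiff.comp (contDiff_const.prodMk
      (((N z.1).contDiff.comp (contDiff_snd.comp σ.contDiff)).add contDiff_const))
  · ext w
    constructor
    · rintro ⟨z, rfl⟩
      refine ⟨(z.1, N z.1 (σ b).2 + z.2), mem_shearDist.2 ?_, rfl⟩
      simpa using z.2.2.1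
    · rintro ⟨v, hv, rfl⟩
      have hv := mem_shearDist.1 hv
      obtain ⟨m, hm, c, hc, hmc⟩ := Submodule.mem_sup.1
        (hC'.sup_eq_top ▸ Submodule.mem_top : v.2 - N v.1 (σ b).2 ∈ μ₀ ⊔ C')
      have hcμ : c ∈ μ := by
        have : c = (v.2 - N v.1 (σ b).2) - m := by rw [← hmc]; abel
        rw [this]
        exact sub_mem hv (hμ hm)
      refine ⟨(v.1, ⟨c, hcμ, hc⟩), ?_⟩
      rw [hGa]
      refine sub_eq_zero.1 ((map_sub π _ _).symm.trans ((hπ _).2 ⟨by simp, ?_⟩))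
      have : N v.1 (σ b).2 + c - v.2 = -m := by
        rw [← sub_eq_iff_eq_add'.2 hmc.symm]; abel
      change N v.1 (σ b).2 + c - v.2 ∈ μ₀
      rwa [this, neg_mem_iff]

end ShearQuotient

/-! ### Parametrizations as local diffeomorphisms, and operations on corresponding distributions. -/

section ParamAtlasCharts

variable {ι E M : Type*} [NormedAddCommGroup E] [NormedSpace ℝ E]

/-- The parametrizations of a parameter atlas as open partial homeomorphisms. -/
def ParamAtlas.homeo (P : ParamAtlas ι E M) (i : ι) :
    letI := P.core.toTopologicalSpace
    OpenPartialHomeomorph E M :=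
  letI := P.core.toTopologicalSpace
  (P.core.openPartialHomeomorph (P.chart i) ⟨i, rfl⟩).symm

lemma ParamAtlas.isLocalDiffeo_homeo (P : ParamAtlas ι E M) (i : ι) :
    letI := P.core.toTopologicalSpace
    letI := P.core.toChartedSpace
    IsLocalDiffeo (E := E) (E' := E) (P.homeo i) := by
  let _ := P.core.toTopologicalSpace
  let _ := P.core.toChartedSpace
  have := P.isManifold
  have h : (P.homeo i).symm ∈ IsManifold.maximalAtlas 𝓘(ℝ, E) ∞ M := by
    refine IsManifold.subset_maximalAtlas ?_
    change (P.homeo i).symm ∈ ⋃ (e : PartialEquiv M E) (he : e ∈ P.core.atlas),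
      {P.core.openPartialHomeomorph e he}
    simp only [mem_iUnion, mem_singleton_iff]
    exact ⟨P.chart i, ⟨i, rfl⟩, rfl⟩
  exact ⟨contMDiffOn_symm_of_mem_maximalAtlas h, contMDiffOn_of_mem_maximalAtlas h⟩

variable {E' M' : Type*} [NormedAddCommGroup E'] [NormedSpace ℝ E']
  [TopologicalSpace M] [ChartedSpace E M] [TopologicalSpace M'] [ChartedSpace E' M']

lemma IsLocalDiffeo.mfderiv_surjective {f : OpenPartialHomeomorph M M'}
    (hf : IsLocalDiffeo (E := E) (E' := E') f) {x : M} (hx : x ∈ f.source) :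
    Function.Surjective (mfderiv 𝓘(ℝ, E) 𝓘(ℝ, E') f x) :=
  (hf.mdifferentiable.mfderiv hx).surjective

lemma IsLocalDiffeo.mfderiv_injective {f : OpenPartialHomeomorph M M'}
    (hf : IsLocalDiffeo (E := E) (E' := E') f) {x : M} (hx : x ∈ f.source) :
    Function.Injective (mfderiv 𝓘(ℝ, E) 𝓘(ℝ, E') f x) :=
  (hf.mdifferentiable.mfderiv hx).injective

lemma IsLocalDiffeo.trans {E'' M'' : Type*} [NormedAddCommGroup E''] [NormedSpace ℝ E'']
    [TopologicalSpace M''] [ChartedSpace E'' M'']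
    {f : OpenPartialHomeomorph M M'} {g : OpenPartialHomeomorph M' M''}
    (hf : IsLocalDiffeo (E := E) (E' := E') f) (hg : IsLocalDiffeo (E := E') (E' := E'') g) :
    IsLocalDiffeo (E := E) (E' := E'') (f.trans g) :=
  ⟨hg.contMDiffOn.comp (hf.contMDiffOn.mono inter_subset_left) inter_subset_right,
    hf.contMDiffOn_symm.comp (hg.contMDiffOn_symm.mono inter_subset_left) inter_subset_right⟩

lemma Corresponds.sup {f : OpenPartialHomeomorph M M'}
    (hf : IsLocalDiffeo (E := E) (E' := E') f) {D₁ D₂ : Distribution E M}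
    {D₁' D₂' : Distribution E' M'} (h₁ : Corresponds f D₁ D₁') (h₂ : Corresponds f D₂ D₂') :
    Corresponds f (fun x => D₁ x ⊔ D₂ x) (fun x => D₁' x ⊔ D₂' x) := by
  intro x hx v
  constructor
  · intro hv
    obtain ⟨v₁, hv₁, v₂, hv₂, rfl⟩ := Submodule.mem_sup.1 hv
    rw [map_add]
    exact Submodule.add_mem_sup ((h₁ x hx _).1 hv₁) ((h₂ x hx _).1 hv₂)
  · intro hv
    obtain ⟨w₁, hw₁, w₂, hw₂, h⟩ := Submodule.mem_sup.1 hv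
    obtain ⟨v₁, rfl⟩ := hf.mfderiv_surjective hx w₁
    obtain ⟨v₂, rfl⟩ := hf.mfderiv_surjective hx w₂
    rw [← map_add] at h
    rw [← hf.mfderiv_injective hx h]
    exact Submodule.add_mem_sup ((h₁ x hx _).2 hw₁) ((h₂ x hx _).2 hw₂)

lemma Corresponds.eq {f : OpenPartialHomeomorph M M'}
    (hf : IsLocalDiffeo (E := E) (E' := E') f) {D : Distribution E M}
    {D' D'' : Distribution E' M'} (h : Corresponds f D D') (h' : Corresponds f D D'')
    {x : M} (hx : x ∈ f.source) : D' (f x) = D'' (f x) := by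
  ext w
  obtain ⟨v, rfl⟩ := hf.mfderiv_surjective hx w
  rw [← h x hx, h' x hx]

end ParamAtlasCharts

/-! ### Straightening coordinates and the derivative of the pullback along them. -/

section Straight

variable {U V W F : Type*} [NormedAddCommGroup U] [NormedSpace ℝ U] [NormedAddCommGroup V]
  [NormedSpace ℝ V] [NormedAddCommGroup W] [NormedSpace ℝ W] [NormedAddCommGroup F]
  [NormedSpace ℝ F] {r p : ℕ}

lemma contDiff_submodule_val {E : Type*} [NormedAddCommGroup E] [NormedSpace ℝ E]
    (p : Submodule ℝ E) : ContDiff ℝ ∞ fun x : p => (x : E) := p.subtypeL.contDiff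

/-- A linear retraction onto the subspace recovers `f` from its composite with the inclusion. -/
lemma contDiff_of_contDiff_val {E : Type*} [NormedAddCommGroup E] [NormedSpace ℝ E]
    [FiniteDimensional ℝ E] (p : Submodule ℝ E) {f : F → p}
    (h : ContDiff ℝ ∞ fun a => (f a : E)) : ContDiff ℝ ∞ f := by
  obtain ⟨ρ, hρ⟩ := p.subtype.exists_leftInverse_of_injective (Submodule.ker_subtype _)
  have h1 := (LinearMap.toContinuousLinearMap ρ).contDiff.comp h
  convert h1 using 1
  funext a
  exact (DFunLike.congr_fun hρ (f a)).symm

lemma hasFDerivAt_val_snd {A E : Type*} [NormedAddCommGroup A] [NormedSpace ℝ A]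
    [NormedAddCommGroup E] [NormedSpace ℝ E] (p : Submodule ℝ E) (a : A × p) :
    HasFDerivAt (fun a : A × p => (a.2 : E)) (p.subtypeL ∘L ContinuousLinearMap.snd ℝ A p) a :=
  (p.subtypeL ∘L ContinuousLinearMap.snd ℝ A p).hasFDerivAt

lemma coe_fderiv {E : Type*} [NormedAddCommGroup E] [NormedSpace ℝ E]
    (p : Submodule ℝ E) {f : F → p} {f' : F →L[ℝ] E} {a : F} (hf : DifferentiableAt ℝ f a)
    (h : HasFDerivAt (fun a => (f a : E)) f' a) (v : F) : (fderiv ℝ f a v : E) = f' v :=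
  DFunLike.congr_fun ((p.subtypeL.hasFDerivAt.comp a hf.hasFDerivAt).unique h) v

/-- A bilinear map on finite-dimensional spaces as a continuous bilinear map. -/
def continuousBilinear {A T : Type*} [NormedAddCommGroup A] [NormedSpace ℝ A]
    [NormedAddCommGroup T] [NormedSpace ℝ T] [FiniteDimensional ℝ A] [FiniteDimensional ℝ T]
    (b : A →ₗ[ℝ] T →ₗ[ℝ] T) : A →L[ℝ] T →L[ℝ] T :=
  LinearMap.toContinuousLinearMap
    ((LinearMap.toContinuousLinearMap : (T →ₗ[ℝ] T) ≃ₗ[ℝ] T →L[ℝ] T).toLinearMap ∘ₗ b)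

lemma contDiff_pull [FiniteDimensional ℝ U] [FiniteDimensional ℝ W] {g : F → U →L[ℝ] V}
    {t : F → SymForm V W r} (hg : ContDiff ℝ ∞ g) (ht : ContDiff ℝ ∞ t) :
    ContDiff ℝ ∞ fun a => pull (g a) (t a) := by
  apply contDiff_of_contDiff_val (symForms U W r)
  have h1 : ContDiff ℝ ∞ fun a => ContinuousMultilinearMap.compContinuousLinearMapContinuousMultilinear
      ℝ (fun _ : Fin r => U) (fun _ : Fin r => V) W (fun _ => g a) :=
    (ContinuousMultilinearMap.contDiff _).comp (contDiff_pi.2 fun _ => hg)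
  exact h1.clm_apply ((contDiff_submodule_val (symForms V W r)).comp ht)

lemma pull_mem_muFilt (g : U ≃L[ℝ] V) {D : Submodule ℝ U} {D' : Submodule ℝ V}
    (h : ∀ u, u ∈ D ↔ g u ∈ D') (f : SymForm V W r) :
    pull (g : U →L[ℝ] V) f ∈ muFilt r p D ↔ f ∈ muFilt r p D' := by
  constructor
  · intro hf S hS w hw
    have := hf S hS (g.symm ∘ w) fun i hi => (h _).2 (by simpa using hw i hi)
    rw [pull_apply] at this
    convert this using 2
    funext i
    simp
  · intro hf S hS w hw
    exact hf S hS _ fun i hi => (h _).1 (hw i hi)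

variable {X Y : Type*} [NormedAddCommGroup X] [NormedSpace ℝ X] [NormedAddCommGroup Y]
  [NormedSpace ℝ Y]

/-- The bilinear action of `Hom(X, Y)` on the symmetric forms on `X × Y`. -/
def nilpAction (X Y W : Type*) [NormedAddCommGroup X] [NormedSpace ℝ X] [NormedAddCommGroup Y]
    [NormedSpace ℝ Y] [NormedAddCommGroup W] [NormedSpace ℝ W] [FiniteDimensional ℝ X]
    [FiniteDimensional ℝ Y] [FiniteDimensional ℝ W] (r : ℕ) :
    (X →L[ℝ] Y) →L[ℝ] SymForm (X × Y) W r →L[ℝ] SymForm (X × Y) W r :=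
  continuousBilinear <|
    LinearMap.mk₂ ℝ (fun (B : X →L[ℝ] Y) (f : SymForm (X × Y) W r) => derivSym (nilp B) f)
      (fun B B' f => by
        ext w
        have h : ∀ i, nilp (B + B') (w i) = nilp B (w i) + nilp B' (w i) := fun i => by
          simp [nilp_apply]
        simp [derivSym_apply, h, Finset.sum_add_distrib])
      (fun c B f => by
        ext w
        have h : ∀ i, nilp (c • B) (w i) = c • nilp B (w i) := fun i => by
          simp [nilp_apply]
        simp [derivSym_apply, h, Finset.smul_sum])
      (fun B f f' => by
        ext w
        simp [derivSym_apply, Finset.sum_add_distrib])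
      (fun c B f => by
        ext w
        simp [derivSym_apply, Finset.smul_sum])

/-- The unipotent automorphism `(x, y) ↦ (x, y + A x)` of `X × Y`. -/
def shear (A : X →L[ℝ] Y) : (X × Y) ≃L[ℝ] X × Y :=
  ContinuousLinearEquiv.equivOfInverse (ContinuousLinearMap.id ℝ _ + nilp A)
    (ContinuousLinearMap.id ℝ _ - nilp A) (fun u => by ext <;> simp [nilp_apply])
    (fun u => by ext <;> simp [nilp_apply])

lemma shear_symm_apply (A : X →L[ℝ] Y) (u : X × Y) : (shear A).symm u = (u.1, u.2 - A u.1) := by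
  ext <;> simp [shear, nilp_apply]

/-- `nilp` as a continuous linear map. -/
def nilpL (X Y : Type*) [NormedAddCommGroup X] [NormedSpace ℝ X] [NormedAddCommGroup Y]
    [NormedSpace ℝ Y] : (X →L[ℝ] Y) →L[ℝ] (X × Y →L[ℝ] X × Y) :=
  (ContinuousLinearMap.compL ℝ (X × Y) Y (X × Y)) (ContinuousLinearMap.inr ℝ X Y) ∘L
    (ContinuousLinearMap.compL ℝ (X × Y) X Y).flip (ContinuousLinearMap.fst ℝ X Y)

lemma contDiff_nilp : ContDiff ℝ ∞ (nilp : (X →L[ℝ] Y) → _) :=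
  contDiff_const.clm_comp (contDiff_id.clm_comp contDiff_const)

variable [FiniteDimensional ℝ X] [FiniteDimensional ℝ Y] [FiniteDimensional ℝ W]

omit [FiniteDimensional ℝ X] [FiniteDimensional ℝ Y] in
lemma coe_trans_shear_symm (e : V ≃L[ℝ] X × Y) (A : X →L[ℝ] Y) :
    ((e.trans (shear A).symm : V ≃L[ℝ] X × Y) : V →L[ℝ] X × Y) =
      (ContinuousLinearMap.id ℝ _ - nilp A) ∘L (e : V →L[ℝ] X × Y) := rfl

omit [FiniteDimensional ℝ X] [FiniteDimensional ℝ Y] in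
lemma coe_trans_shear_symm_symm (e : V ≃L[ℝ] X × Y) (A : X →L[ℝ] Y) :
    ((e.trans (shear A).symm).symm : X × Y →L[ℝ] V) =
      (e.symm : X × Y →L[ℝ] V) ∘L (ContinuousLinearMap.id ℝ _ + nilp A) := rfl

omit [FiniteDimensional ℝ X] [FiniteDimensional ℝ Y] in
lemma contDiff_pull_shear [FiniteDimensional ℝ V] (e : V ≃L[ℝ] X × Y) :
    ContDiff ℝ ∞ fun a : (X →L[ℝ] Y) × SymForm (X × Y) W r =>
      pull ((e.trans (shear a.1).symm : V ≃L[ℝ] X × Y) : V →L[ℝ] X × Y) a.2 := by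
  simp only [coe_trans_shear_symm]
  refine contDiff_pull (ContDiff.clm_comp ?_ contDiff_const) contDiff_snd
  exact contDiff_const.sub (contDiff_nilp.comp contDiff_fst)

lemma contDiff_pull_shear_symm (e : V ≃L[ℝ] X × Y) :
    ContDiff ℝ ∞ fun a : (X →L[ℝ] Y) × SymForm V W r =>
      pull ((e.trans (shear a.1).symm).symm : X × Y →L[ℝ] V) a.2 := by
  simp only [coe_trans_shear_symm_symm]
  refine contDiff_pull (contDiff_const.clm_comp ?_) contDiff_snd
  exact contDiff_const.add (contDiff_nilp.comp contDiff_fst)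

omit [FiniteDimensional ℝ X] [FiniteDimensional ℝ Y] in
lemma hasFDerivAt_shear_symm_comp {T : Type*} [NormedAddCommGroup T] [NormedSpace ℝ T]
    (e : V ≃L[ℝ] X × Y) (a : (X →L[ℝ] Y) × T) :
    HasFDerivAt (fun a : (X →L[ℝ] Y) × T =>
      (ContinuousLinearMap.id ℝ _ - nilp a.1) ∘L (e : V →L[ℝ] X × Y))
      (-((ContinuousLinearMap.compL ℝ V (X × Y) (X × Y)).flip (e : V →L[ℝ] X × Y) ∘L
        nilpL X Y ∘L ContinuousLinearMap.fst ℝ _ T)) a :=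
  (((ContinuousLinearMap.compL ℝ V (X × Y) (X × Y)).flip (e : V →L[ℝ] X × Y) ∘L
    nilpL X Y ∘L ContinuousLinearMap.fst ℝ _ T).hasFDerivAt
      (x := a)).const_sub (e : V →L[ℝ] X × Y)

/-- The product rule gives one term from varying the form and one from varying each slot, where the
straightening map changes by `-nilp B ∘ e`. The slot terms add up to `-N_B`, pulled back by the same
straightening map. -/
lemma fderiv_pull_shear [FiniteDimensional ℝ V] (e : V ≃L[ℝ] X × Y)
    (a v : (X →L[ℝ] Y) × SymForm (X × Y) W r) :
    fderiv ℝ (fun a : (X →L[ℝ] Y) × SymForm (X × Y) W r =>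
      pull ((e.trans (shear a.1).symm : V ≃L[ℝ] X × Y) : V →L[ℝ] X × Y) a.2) a v =
      pull ((e.trans (shear a.1).symm : V ≃L[ℝ] X × Y) : V →L[ℝ] X × Y)
        (v.2 - nilpAction X Y W r v.1 a.2) := by
  have hd := ((contDiff_pull_shear (r := r) (W := W) e).contDiffAt (x := a)).differentiableAt
    (by simp)
  simp only [coe_trans_shear_symm] at hd ⊢
  have h1 := hasFDerivAt_val_snd (A := X →L[ℝ] Y) (symForms (X × Y) W r) a
  have h2 := hasFDerivAt_shear_symm_comp (T := symForms (X × Y) W r) e a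
  have h3 := h1.continuousMultilinearMapCompContinuousLinearMap (fun _ : Fin r => h2)
  refine Subtype.ext ((coe_fderiv (symForms V W r) hd h3 v).trans ?_)
  ext w
  -- Products of two maps `nilp` vanish, so the varied slot can be expressed through the
  -- straightened vector.
  have h4 : ∀ u : V, nilp v.1 ((ContinuousLinearMap.id ℝ (X × Y) - nilp a.1) (e u)) = nilp v.1 (e u) :=
    fun u => by simp [nilp_apply]
  have h5 : ∀ (i : Fin r) (j : Fin r),
      Function.update (fun _ : Fin r => (ContinuousLinearMap.id ℝ (X × Y) - nilp a.1) ∘L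
        (e : V →L[ℝ] X × Y)) i (-(nilp v.1 ∘L (e : V →L[ℝ] X × Y))) j (w j) =
      Function.update (fun j => (ContinuousLinearMap.id ℝ (X × Y) - nilp a.1) (e (w j))) i
        (-(nilp v.1 (e (w i)))) j := by
    intro i j
    rcases eq_or_ne j i with rfl | h <;> simp [*]
  trans v.2.1 (fun i => (ContinuousLinearMap.id ℝ (X × Y) - nilp a.1) (e (w i))) +
    ∑ i, a.2.1 (fun j => Function.update (fun _ : Fin r => (ContinuousLinearMap.id ℝ (X × Y) - nilp a.1) ∘L
        (e : V →L[ℝ] X × Y)) i (-(nilp v.1 ∘L (e : V →L[ℝ] X × Y))) j (w j))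
  · exact congrArg (HAdd.hAdd (v.2.1 fun i => (ContinuousLinearMap.id ℝ (X × Y) - nilp a.1) (e (w i))))
      (ContinuousMultilinearMap.fderivCompContinuousLinearMap_apply (ι := Fin r) _ _
        (fun _ => -(nilp v.1 ∘L (e : V →L[ℝ] X × Y))) _)
  · trans v.2.1 (fun i => (ContinuousLinearMap.id ℝ (X × Y) - nilp a.1) (e (w i))) -
      (derivSym (nilp v.1) a.2).1 (fun i => (ContinuousLinearMap.id ℝ (X × Y) - nilp a.1) (e (w i)))
    · rw [derivSym_apply]
      refine Eq.trans (congrArg _ ?_) (sub_eq_add_neg _ _).symm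
      rw [← Finset.sum_neg_distrib]
      refine Finset.sum_congr rfl fun i _ => ?_
      rw [h4]
      refine Eq.trans ?_ (a.2.1.toMultilinearMap.map_update_neg _ _ _)
      exact congrArg a.2.1 (funext (h5 i))
    · rfl

end Straight

/-! ### Chain rule through a local diffeomorphism. -/

section ChainRule

variable {E E' E'' M M' M'' : Type*} [NormedAddCommGroup E] [NormedSpace ℝ E]
  [NormedAddCommGroup E'] [NormedSpace ℝ E'] [NormedAddCommGroup E''] [NormedSpace ℝ E'']
  [TopologicalSpace M] [ChartedSpace E M] [TopologicalSpace M'] [ChartedSpace E' M']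
  [TopologicalSpace M''] [ChartedSpace E'' M'']

/-- Differentiability of `g` need not be known beforehand: near `f x` it equals `h ∘ f.symm`. -/
lemma IsLocalDiffeo.mfderiv_comp_apply {f : OpenPartialHomeomorph M M'}
    (hf : IsLocalDiffeo (E := E) (E' := E') f) {g : M' → M''} {h : M → M''} (hgh : ∀ x, g (f x) = h x)
    {x : M} (hx : x ∈ f.source) (hh : MDifferentiableAt 𝓘(ℝ, E) 𝓘(ℝ, E'') h x)
    (v : TangentSpace 𝓘(ℝ, E) x) :
    (mfderiv 𝓘(ℝ, E') 𝓘(ℝ, E'') g (f x) (mfderiv 𝓘(ℝ, E) 𝓘(ℝ, E') f x v) : E'') =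
      mfderiv 𝓘(ℝ, E) 𝓘(ℝ, E'') h x v := by
  obtain rfl : g ∘ f = h := funext hgh
  have hy : f x ∈ f.target := f.map_source hx
  have h1 : MDifferentiableAt 𝓘(ℝ, E') 𝓘(ℝ, E'') ((g ∘ f) ∘ f.symm) (f x) := by
    refine MDifferentiableAt.comp (f x) ?_ (hf.mdifferentiable.mdifferentiableAt_symm hy)
    rwa [f.left_inv hx]
  have h2 : MDifferentiableAt 𝓘(ℝ, E') 𝓘(ℝ, E'') g (f x) := by
    refine h1.congr_of_eventuallyEq ?_
    filter_upwards [f.open_target.mem_nhds hy] with y hy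
    exact (congrArg g (f.right_inv hy)).symm
  exact (DFunLike.congr_fun (mfderiv_comp x h2 (hf.mdifferentiable.mdifferentiableAt hx)) v).symm

end ChainRule

/-- Split `(B, t')` as `(0, t' - N_B t) + (B, N_B t)`; this is the sum that defines `F^p`, in
adapted coordinates. -/
lemma fiberDist_sup_shearDist_bot {A T : Type*} [NormedAddCommGroup A] [NormedSpace ℝ A]
    [NormedAddCommGroup T] [NormedSpace ℝ T] (N : A →L[ℝ] T →L[ℝ] T) (μ : Submodule ℝ T) :
    (fun a => fiberDist A μ a ⊔ shearDist N ⊥ a : Distribution (A × T) (A × T)) =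
      shearDist N μ := by
  funext a
  ext v
  refine Submodule.mem_sup.trans (Iff.trans ?_ mem_shearDist.symm)
  constructor
  · rintro ⟨u, hu, w, hw, rfl⟩
    obtain ⟨h1, h2⟩ := mem_fiberDist.1 hu
    have h3 := sub_eq_zero.1 ((Submodule.mem_bot ℝ).1 (mem_shearDist.1 hw))
    change u.2 + w.2 - N (u.1 + w.1) a.2 ∈ μ
    rw [h1, zero_add, h3, add_sub_cancel_right]
    exact h2
  · intro hv
    refine ⟨(0, v.2 - N v.1 a.2), mem_fiberDist.2 ⟨rfl, hv⟩, (v.1, N v.1 a.2),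
      mem_shearDist.2 ((Submodule.mem_bot ℝ).2 (sub_self _)), ?_⟩
    exact Prod.ext (zero_add _) (sub_add_cancel _ _)

/-! ### Adapted coordinates on the space of flags; the distributions in them. -/

section AdaptedParam

variable {V W : Type*} [NormedAddCommGroup V] [NormedSpace ℝ V] [FiniteDimensional ℝ V]
  [NormedAddCommGroup W] [NormedSpace ℝ W] [FiniteDimensional ℝ W] {k l p : ℕ}

variable (V W) in
/-- The model of the space of flags: the graph coordinates of the direction, and the form in
coordinates where the direction is the first factor. -/
abbrev AdaptedModel (k l : ℕ) :=
  GrModel V l × SymForm ((Fin l → ℝ) × (Fin (finrank ℝ V - l) → ℝ)) W (k + 1)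

/-- The coordinates on `V` in which the plane `y = A x` is the first factor. -/
def straighten (e : GrFrame V l) (A : GrModel V l) : GrFrame V l := e.trans (shear A).symm

omit [FiniteDimensional ℝ V] in
lemma mem_grGraph_iff_straighten (e : GrFrame V l) (A : GrModel V l) (v : V) :
    v ∈ (grGraph e A).plane ↔ straighten e A v ∈ firstFactor (Fin l → ℝ) _ := by
  rw [mem_grGraph, mem_firstFactor]
  change _ ↔ ((shear A).symm (e v)).2 = 0
  rw [shear_symm_apply, sub_eq_zero]

/-- The change between the adapted coordinates of a flag and its standard coordinates. -/
def adaptedHomeo (W : Type*) [NormedAddCommGroup W] [NormedSpace ℝ W] [FiniteDimensional ℝ W]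
    (k : ℕ) (e : GrFrame V l) : AdaptedModel V W k l ≃ₜ FlagModel V W k l where
  toFun a := (a.1, pull (straighten e a.1 : V →L[ℝ] _) a.2)
  invFun b := (b.1, pull ((straighten e b.1).symm : _ →L[ℝ] V) b.2)
  left_inv a := Prod.ext rfl <| by
    change pull _ (pull _ a.2) = a.2
    rw [pull_pull]
    exact (congrArg (fun g => pull g a.2) (straighten e a.1).coe_comp_coe_symm).trans (pull_id _)
  right_inv b := Prod.ext rfl <| by
    change pull _ (pull _ b.2) = b.2
    rw [pull_pull]
    exact (congrArg (fun g => pull g b.2) (straighten e b.1).coe_symm_comp_coe).trans (pull_id _)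
  continuous_toFun := (contDiff_fst.prodMk (contDiff_pull_shear e)).continuous
  continuous_invFun := (contDiff_fst.prodMk (contDiff_pull_shear_symm e)).continuous

lemma isLocalDiffeo_adaptedHomeo (e : GrFrame V l) :
    IsLocalDiffeo (E := AdaptedModel V W k l) (E' := FlagModel V W k l)
      (adaptedHomeo W k e).toOpenPartialHomeomorph :=
  ⟨(contDiff_fst.prodMk (contDiff_pull_shear e)).contMDiff.contMDiffOn,
    (contDiff_fst.prodMk (contDiff_pull_shear_symm e)).contMDiff.contMDiffOn⟩

variable (θ : Jet V W k)

/-- The parametrization of flags by adapted coordinates. -/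
def adaptedParam (e : GrFrame V l) : OpenPartialHomeomorph (AdaptedModel V W k l) (Flag θ l) :=
  (adaptedHomeo W k e).toOpenPartialHomeomorph.trans ((flagAtlas θ l).homeo e)

lemma isLocalDiffeo_adaptedParam (e : GrFrame V l) :
    IsLocalDiffeo (E := AdaptedModel V W k l) (E' := FlagModel V W k l) (adaptedParam θ e) :=
  (isLocalDiffeo_adaptedHomeo e).trans ((flagAtlas θ l).isLocalDiffeo_homeo e)

lemma adaptedParam_source (e : GrFrame V l) : (adaptedParam θ e).source = univ := by
  simp [adaptedParam, ParamAtlas.homeo, ParamAtlas.chart, ChartedSpaceCore.openPartialHomeomorph]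

lemma mem_adaptedParam_source (e : GrFrame V l) (a : AdaptedModel V W k l) :
    a ∈ (adaptedParam θ e).source := by
  rw [adaptedParam_source]; trivial

lemma dir_adaptedParam (e : GrFrame V l) (a : AdaptedModel V W k l) :
    (adaptedParam θ e a).dir = grGraph e a.1 :=
  Flag.dir_ofDirJet _ _

lemma jet_adaptedParam (e : GrFrame V l) (a : AdaptedModel V W k l) :
    (adaptedParam θ e a).jet = pull (straighten e a.1 : V →L[ℝ] _) a.2 :=
  Flag.jet_ofDirJet _ _

lemma exists_adaptedParam_eq (e : GrFrame V l) (F : Flag θ l) (h : F.dir ∈ range (grGraph e)) :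
    ∃ a, adaptedParam θ e a = F := by
  obtain ⟨A, hA⟩ := h
  refine ⟨(adaptedHomeo W k e).symm (A, F.jet), ?_⟩
  have h1 : adaptedParam θ e ((adaptedHomeo W k e).symm (A, F.jet)) = flagParam θ e (A, F.jet) :=
    congrArg (flagParam θ e) ((adaptedHomeo W k e).apply_symm_apply (A, F.jet))
  rw [h1, flagParam, hA, F.ofDirJet_dir_jet]

lemma exists_adaptedParam (F : Flag θ l) : ∃ (e : GrFrame V l) (a : _), adaptedParam θ e a = F := by
  obtain ⟨e, A, hA⟩ := exists_grGraph F.dir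
  exact ⟨e, exists_adaptedParam_eq θ e F ⟨A, hA⟩⟩

/-- The form with constant jet is sheared when the direction moves; this is the source of the term
with `nilpAction`. -/
lemma dJet_adaptedParam (e : GrFrame V l) (a v : AdaptedModel V W k l) :
    dJet (adaptedParam θ e a) (mfderiv 𝓘(ℝ, AdaptedModel V W k l) 𝓘(ℝ, FlagModel V W k l)
      (adaptedParam θ e) a v) =
    pull (straighten e a.1 : V →L[ℝ] _) (v.2 - nilpAction _ _ W (k + 1) v.1 a.2) := by
  have h := contDiff_pull_shear (W := W) (r := k + 1) e
  have h1 := (isLocalDiffeo_adaptedParam θ e).mfderiv_comp_apply (jet_adaptedParam θ e)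
    (mem_adaptedParam_source θ e a) (h.contMDiff.mdifferentiable (by simp) a) v
  refine h1.trans (Eq.trans ?_ (fderiv_pull_shear e a v))
  rw [mfderiv_eq_fderiv]
  rfl

lemma dDir_adaptedParam (e : GrFrame V l) (a v : AdaptedModel V W k l) :
    dDir (adaptedParam θ e a) (mfderiv 𝓘(ℝ, AdaptedModel V W k l) 𝓘(ℝ, FlagModel V W k l)
      (adaptedParam θ e) a v) = 0 ↔ v.1 = 0 := by
  have hG := (grAtlas V l).isLocalDiffeo_homeo e
  have hs : a.1 ∈ ((grAtlas V l).homeo e).source := by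
    simp [ParamAtlas.homeo, ParamAtlas.chart, ChartedSpaceCore.openPartialHomeomorph]
  have h2 := hG.mdifferentiable.mdifferentiableAt hs
  have h3 : MDifferentiableAt 𝓘(ℝ, AdaptedModel V W k l) 𝓘(ℝ, GrModel V l)
      (Prod.fst : AdaptedModel V W k l → GrModel V l) a :=
    contDiff_fst.contMDiff.mdifferentiable (n := ∞) (by simp) a
  have h1 := (isLocalDiffeo_adaptedParam θ e).mfderiv_comp_apply (dir_adaptedParam θ e)
    (mem_adaptedParam_source θ e a) (MDifferentiableAt.comp a h2 h3) v
  have h4 := DFunLike.congr_fun (mfderiv_comp a h2 h3) v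
  have h5 : mfderiv 𝓘(ℝ, AdaptedModel V W k l) 𝓘(ℝ, GrModel V l)
      (Prod.fst : AdaptedModel V W k l → GrModel V l) a v = v.1 := by
    rw [mfderiv_eq_fderiv]
    exact DFunLike.congr_fun (fderiv_fst (p := a)) v
  have h6 : mfderiv 𝓘(ℝ, GrModel V l) 𝓘(ℝ, GrModel V l) ((grAtlas V l).homeo e) a.1 v.1 = 0 ↔
      v.1 = 0 := map_eq_zero_iff _ (hG.mfderiv_injective hs)
  refine Iff.trans ?_ h6
  refine Eq.congr (h1.trans (h4.trans ?_)) rfl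
  exact congrArg (mfderiv 𝓘(ℝ, GrModel V l) 𝓘(ℝ, GrModel V l) ((grAtlas V l).homeo e) a.1) h5

lemma plane_adaptedParam (e : GrFrame V l) (a : AdaptedModel V W k l) :
    (adaptedParam θ e a).dir.plane = (grGraph e a.1).plane := by
  rw [dir_adaptedParam]

omit [FiniteDimensional ℝ V] [FiniteDimensional ℝ W] in
lemma pull_eq_zero_iff {U : Type*} [NormedAddCommGroup U] [NormedSpace ℝ U] {r : ℕ} (g : U ≃L[ℝ] V)
    (f : SymForm V W r) : pull (g : U →L[ℝ] V) f = 0 ↔ f = 0 := by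
  refine ⟨fun h => ?_, fun h => by rw [h, map_zero]⟩
  have h1 := congrArg (pull (g.symm : V →L[ℝ] U)) h
  rw [pull_pull, map_zero] at h1
  exact ((congrArg (fun g => pull g f) g.coe_comp_coe_symm).trans (pull_id f)).symm.trans h1

lemma corresponds_vertDist (e : GrFrame V l) :
    Corresponds (adaptedParam θ e) (fiberDist (GrModel V l)
      (muFilt (W := W) (k + 1) p (firstFactor (Fin l → ℝ) (Fin (finrank ℝ V - l) → ℝ))))
      (vertDist θ l p) := by
  intro a _ v
  have h2 : dJet (adaptedParam θ e a) (mfderiv 𝓘(ℝ, AdaptedModel V W k l)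
      𝓘(ℝ, FlagModel V W k l) (adaptedParam θ e) a v) ∈
        muFilt (k + 1) p (adaptedParam θ e a).dir.plane ↔
      v.2 - nilpAction _ _ W (k + 1) v.1 a.2 ∈ muFilt (k + 1) p (firstFactor _ _) := by
    rw [plane_adaptedParam]
    refine Iff.trans (Eq.to_iff (congrArg (· ∈ _) (dJet_adaptedParam θ e a v))) ?_
    exact pull_mem_muFilt (straighten e a.1) (mem_grGraph_iff_straighten e a.1) _
  refine (mem_fiberDist).trans (Iff.trans ?_ (Iff.and (dDir_adaptedParam θ e a v) h2).symm)
  refine and_congr_right fun h => ?_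
  -- Along vectors with fixed direction the shearing term disappears, which makes the distribution
  -- constant.
  have h3 : nilpAction _ _ W (k + 1) v.1 a.2 = 0 := by
    rw [h, map_zero]; rfl
  rw [h3, sub_zero]

lemma corresponds_vertJet (e : GrFrame V l) :
    Corresponds (adaptedParam θ e) (shearDist (nilpAction _ _ W (k + 1)) ⊥) (vertJet θ l) := by
  intro a _ v
  refine mem_shearDist.trans (Iff.trans ?_
    (Eq.to_iff (congrArg (· = 0) (dJet_adaptedParam θ e a v))).symm)
  rw [Submodule.mem_bot]
  exact (pull_eq_zero_iff (straighten e a.1) _).symm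

lemma corresponds_flagDist (e : GrFrame V l) :
    Corresponds (adaptedParam θ e) (shearDist (nilpAction _ _ W (k + 1))
      (muFilt (W := W) (k + 1) (p + 1) (firstFactor (Fin l → ℝ) (Fin (finrank ℝ V - l) → ℝ))))
      (flagDist θ l p) := by
  have h := Corresponds.sup (isLocalDiffeo_adaptedParam θ e)
    (corresponds_vertDist (p := p + 1) θ e) (corresponds_vertJet θ e)
  exact Eq.mp (congrArg (fun D => Corresponds (adaptedParam θ e) D (flagDist θ l p))
    (fiberDist_sup_shearDist_bot _ _)) h

end AdaptedParam

/-! ### Descent for a manifold covered by copies of the model. -/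

section Descent

variable {ι A T E M : Type*} [NormedAddCommGroup A] [NormedSpace ℝ A] [FiniteDimensional ℝ A]
  [NormedAddCommGroup T] [NormedSpace ℝ T] [FiniteDimensional ℝ T]
  [NormedAddCommGroup E] [NormedSpace ℝ E] [TopologicalSpace M] [ChartedSpace E M]

lemma descendsToLeafSpace_of_corresponds [IsManifold 𝓘(ℝ, E) ∞ M] {μ₀ μ : Submodule ℝ T}
    {N : A →L[ℝ] T →L[ℝ] T}
    {K D : Distribution E M} {r : Setoid M} {f : ι → OpenPartialHomeomorph (A × T) M}
    (hμ : μ₀ ≤ μ) (h0 : ∀ B, ∀ m ∈ μ₀, N B m ∈ μ) (hs : ∀ i, (f i).source = univ)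
    (hf : ∀ i, IsLocalDiffeo (E := A × T) (E' := E) (f i)) (hc : ∀ x, ∃ i a, f i a = x)
    (hK : ∀ i, Corresponds (f i) (fiberDist A μ₀) K)
    (hD : ∀ i, Corresponds (f i) (shearDist N μ) D)
    (hr : ∀ i a y, r (f i a) y → ∃ b, f i b = y)
    (hr' : ∀ i a b, r (f i a) (f i b) ↔ a.1 = b.1 ∧ a.2 - b.2 ∈ μ₀) :
    DescendsToLeafSpace D K := by
  obtain ⟨d, π, σ, hσ, hπ⟩ := exists_quotient_fiberDist A μ₀
  let P : FoliatedAtlas ι (A × T) (EuclideanSpace ℝ (Fin d)) K r :=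
    { param := f
      π := π
      σ := σ
      π_σ := hσ
      source_eq := hs
      isLocalDiffeo := hf
      cover := hc
      corresponds := fun i a ha v => (hπ v).trans (hK i a ha v)
      saturated := hr
      rel_iff := fun i a b => by
        rw [hr', ← sub_eq_zero (a := π a), ← map_sub, hπ, Prod.fst_sub, Prod.snd_sub, sub_eq_zero] }
  exact P.descendsToLeafSpace (D' := fun _ => shearImage N μ π σ)
    (fun i a ha v => (mem_shearImage hμ h0 hσ hπ a v).trans (hD i a ha v))
    fun _ => isSmoothDistribution_shearImage hμ hπ

end Descent

/-! ### Application to the space of integral flags. -/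

section Flags

variable {V W : Type*} [NormedAddCommGroup V] [NormedSpace ℝ V] [FiniteDimensional ℝ V]
  [NormedAddCommGroup W] [NormedSpace ℝ W] [FiniteDimensional ℝ W] {k l p : ℕ}

lemma nilpAction_comm {X Y : Type*} [NormedAddCommGroup X] [NormedSpace ℝ X]
    [NormedAddCommGroup Y] [NormedSpace ℝ Y] [FiniteDimensional ℝ X] [FiniteDimensional ℝ Y] {r : ℕ}
    (B B' : X →L[ℝ] Y) (f : SymForm (X × Y) W r) :
    nilpAction X Y W r B (nilpAction X Y W r B' f) =
      nilpAction X Y W r B' (nilpAction X Y W r B f) :=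
  derivSym_comm (fun u => by simp [nilp_apply]) (fun u => by simp [nilp_apply]) f

omit [FiniteDimensional ℝ W] in
lemma muFilt_eq_top {U : Type*} [NormedAddCommGroup U] [NormedSpace ℝ U] {r : ℕ} (hp : r < p)
    (D : Submodule ℝ U) : (muFilt r p D : Submodule ℝ (SymForm U W r)) = ⊤ := by
  rw [eq_top_iff]
  intro f _ S hS
  have := S.card_le_univ
  rw [Fintype.card_fin] at this
  omega

variable (θ : Jet V W k)

theorem charDistribution_flagDist (hl : 1 ≤ l) (hW : 1 ≤ finrank ℝ W) (hp : p ≤ k) :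
    charDistribution (flagDist θ l p) = vertDist θ l p := by
  -- Nontriviality of `W` enters through the monomial test form, that of `Fin l → ℝ` through the
  -- choice of a vector `x` with `B x = y`.
  have : Nontrivial W := nontrivial_of_finrank_pos hW
  have : Nonempty (Fin l) := ⟨⟨0, hl⟩⟩
  funext F
  obtain ⟨e, a, rfl⟩ := exists_adaptedParam θ F
  have h := (isLocalDiffeo_adaptedParam θ e).corresponds_charDistribution
    (corresponds_flagDist (p := p) θ e)
  have hc := charDistribution_shearDist (A := GrModel V l)
    (T := SymForm ((Fin l → ℝ) × (Fin (finrank ℝ V - l) → ℝ)) W (k + 1))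
    (N := nilpAction _ _ W (k + 1)) (μ := muFilt (k + 1) (p + 1) (firstFactor _ _))
    (μ₀ := muFilt (k + 1) p (firstFactor _ _)) nilpAction_comm (muFilt_le_succ _)
    (fun B m hm => derivSym_mem_muFilt (nilp B) hm)
    -- The forms have degree `k + 1`, so `p ≤ k` is the condition that a slot remains free.
    (fun m hm h => mem_muFilt_of_derivSym_mem (by omega) hm h)
    (fun B h => eq_zero_of_derivSym_mem (by omega) h)
  replace h := Eq.mp (congrArg (fun D => Corresponds (adaptedParam θ e) D
    (charDistribution (flagDist θ l p))) hc) h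
  exact h.eq (isLocalDiffeo_adaptedParam θ e) (corresponds_vertDist θ e)
    (mem_adaptedParam_source θ e a)

theorem flagDist_eq_top (hp : k < p) : flagDist θ l p = fun _ => ⊤ := by
  funext F
  obtain ⟨e, a, rfl⟩ := exists_adaptedParam θ F
  rw [eq_top_iff]
  intro w _
  obtain ⟨v, rfl⟩ := (isLocalDiffeo_adaptedParam θ e).mfderiv_surjective
    (mem_adaptedParam_source θ e a) w
  refine (corresponds_flagDist θ e a (mem_adaptedParam_source θ e a) v).1 (mem_shearDist.2 ?_)
  -- A form of degree `k + 1` has no `p + 1` slots when `p > k`, so the defining condition is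
  -- vacuous.
  rw [muFilt_eq_top (by omega)]
  trivial

theorem charDistribution_top_flag :
    charDistribution (fun _ => ⊤ : Distribution (FlagModel V W k l) (Flag θ l)) = fun _ => ⊤ := by
  funext F
  obtain ⟨e, a, rfl⟩ := exists_adaptedParam θ F
  have h := (isLocalDiffeo_adaptedParam θ e).corresponds_charDistribution
    (D := fun _ => ⊤) (D' := fun _ => ⊤) (fun _ _ _ => Iff.rfl)
  have h' := Eq.mp (congrArg (fun D => Corresponds (adaptedParam θ e) D
    (charDistribution (fun _ => ⊤ : Distribution (FlagModel V W k l) (Flag θ l))))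
      charDistribution_top) h
  exact h'.eq (isLocalDiffeo_adaptedParam θ e) (D'' := fun _ => ⊤) (fun _ _ _ => Iff.rfl)
    (mem_adaptedParam_source θ e a)

/-- Two flags are equivalent if they have the same direction and their jets differ by a form that
vanishes as soon as `p` of its arguments lie in this direction. -/
def leafRel (l p : ℕ) : Setoid (Flag θ l) where
  r F F' := F.dir = F'.dir ∧ F.jet - F'.jet ∈ muFilt (k + 1) p F.dir.plane
  iseqv :=
    { refl := fun F => ⟨rfl, by rw [sub_self]; exact zero_mem _⟩
      symm := fun {F F'} h => ⟨h.1.symm, by rw [← h.1, ← neg_sub]; exact neg_mem h.2⟩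
      trans := fun {F F' F''} h h' => ⟨h.1.trans h'.1, by
        rw [← sub_add_sub_cancel F.jet F'.jet]
        exact add_mem h.2 (h.1 ▸ h'.2)⟩ }

lemma leafRel_adaptedParam (e : GrFrame V l) (a b : AdaptedModel V W k l) :
    leafRel θ l p (adaptedParam θ e a) (adaptedParam θ e b) ↔
      a.1 = b.1 ∧ a.2 - b.2 ∈ muFilt (k + 1) p (firstFactor (Fin l → ℝ) _) := by
  change (adaptedParam θ e a).dir = (adaptedParam θ e b).dir ∧
    (adaptedParam θ e a).jet - (adaptedParam θ e b).jet ∈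
      muFilt (k + 1) p (adaptedParam θ e a).dir.plane ↔ _
  rw [dir_adaptedParam, dir_adaptedParam, (grGraph_injective e).eq_iff, jet_adaptedParam,
    jet_adaptedParam]
  refine and_congr_right fun h => ?_
  rw [← h, ← map_sub]
  exact pull_mem_muFilt (straighten e a.1) (mem_grGraph_iff_straighten e a.1) _

theorem descendsToLeafSpace_flagDist (l p : ℕ) :
    DescendsToLeafSpace (flagDist θ l p) (vertDist θ l p) := by
  refine descendsToLeafSpace_of_corresponds (A := GrModel V l)
    (T := SymForm ((Fin l → ℝ) × (Fin (finrank ℝ V - l) → ℝ)) W (k + 1))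
    (f := adaptedParam θ) (N := nilpAction _ _ W (k + 1))
    (μ₀ := muFilt (k + 1) p (firstFactor _ _)) (μ := muFilt (k + 1) (p + 1) (firstFactor _ _))
    (r := leafRel θ l p) ?_ ?_ ?_ ?_ ?_ ?_ ?_ ?_ ?_
  · exact muFilt_le_succ _
  · exact fun B m hm => derivSym_mem_muFilt (nilp B) hm
  · exact adaptedParam_source θ
  · exact isLocalDiffeo_adaptedParam θ
  · exact exists_adaptedParam θ
  · exact corresponds_vertDist θ
  · exact corresponds_flagDist θ
  · exact fun e a F h => exists_adaptedParam_eq θ e F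
      ⟨a.1, (dir_adaptedParam θ e a).symm.trans h.1⟩
  · exact leafRel_adaptedParam θ

end Flags
end FlagJets
end

theorem mainTheorem3 {V W : Type*} [NormedAddCommGroup V] [NormedSpace ℝ V]
    [FiniteDimensional ℝ V] [NormedAddCommGroup W] [NormedSpace ℝ W] [FiniteDimensional ℝ W]
    (k l : ℕ) (hk : 1 ≤ k) (hl : 1 ≤ l) (hln : l < Module.finrank ℝ V)
    (hW : 1 ≤ Module.finrank ℝ W) (θ : FlagJets.Jet V W k) :
    (∀ p ≤ k, FlagJets.charDistribution (FlagJets.flagDist θ l p) = FlagJets.vertDist θ l p) ∧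
    (FlagJets.charDistribution (FlagJets.flagDist θ l (k + 1)) = fun _ => ⊤) ∧
    (∀ p ≤ k + 1,
      FlagJets.DescendsToLeafSpace (FlagJets.flagDist θ l p) (FlagJets.vertDist θ l p)) := by
  refine ⟨fun p hp => FlagJets.charDistribution_flagDist θ hl hW hp, ?_,
    fun p _ => FlagJets.descendsToLeafSpace_flagDist θ l p⟩
  rw [FlagJets.flagDist_eq_top θ k.lt_succ_self]
  exact FlagJets.charDistribution_top_flag θ
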